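/- Let $T_p(X)=(1-p)X+p\,\mathrm{Tr}(X)\,\frac{I}{2}$ be the single-qubit depolarizing channel, $0\le p\le 4/3$ (the range of $p$ for which $T_p$ is completely positive), and let $\tau_p=(T_p\otimes\mathrm{id})(|\Omega\rangle\langle\Omega|)$, $|\Omega\rangle=\frac{1}{\sqrt2}(|00\rangle+|11\rangle)$, be its Choi state, with von Neumann entropy $S(\tau_p)=-\mathrm{Tr}\,\tau_p\log_2\tau_p$. A probability measure $\mu$ on the pure states of $\mathbb C^d$ is called a state 2-design if $\mathbb E_{\rho\sim\mu}[\rho^{\otimes 2}]=\mathbb E_{U}[(U\rho_0U^\dagger)^{\otimes 2}]$, where $\rho_0$ is a fixed pure state and $U$ is Haar distributed on $U(d)$; for instance, $\mu$ may be the law of $U\rho_0U^\dagger$ with $U$ drawn from a unitary 2-design. For a linear map $T$ on $d\times d$ matrices and a measure $\nu$ on pairs of states, the average contraction of the trace distance is $$\eta_1(T,\|\cdot\|_1,\nu)=\mathbb E_{(\rho,\sigma)\sim\nu}\left[\frac{\|T(\rho)-T(\sigma)\|_1}{\|\rho-\sigma\|_1}\right],$$ the ratio being read as $0$ when $\rho=\sigma$.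 Let $\mu^{(2)}$ be $\mu\times\mu$ conditioned on $\rho\neq\sigma$ (so $\mu^{(2)}=\mu\times\mu$ if collisions have probability zero). Then there is a number $p_1$ with $|p_1-0.25|<0.005$ that is the unique $p\in[0,4/3]$ with $S(\tau_p)=1$; equivalently, it is the unique solution in $[0,4/3]$ of $$\left(1-\tfrac34p\right)\log_2\left(1-\tfrac34p\right)+\tfrac{3p}{4}\log_2\tfrac p4=-1$$ (with $0\log_2 0=0$). Put $p_2=1-\frac{1}{\sqrt3}$, so that $|p_2-0.42|<0.005$. For every $p\in[0,4/3]$ and every sequence $(\mu_n)_n$, where $\mu_n$ is a state 2-design on pure states of $n$ qubits, $$\lim_{n\to\infty}\eta_1(T_p^{\otimes n},\|\cdot\|_1,\mu_n\times\mu_n)=\begin{cases}1&\text{if }p<p_1,\\0&\text{if }p>p_2,\end{cases}$$ and the same holds with $\mu_n^{(2)}$ in place of $\mu_n\times\mu_n$. -/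

import Mathlib

open MeasureTheory Filter Topology

noncomputable section

namespace QContraction

/-! ### Operators, states, trace distance, entropy -/

section Operators

variable {d : Type*} [Fintype d] [DecidableEq d]

/-- The trace norm (Schatten `1`-norm): the sum of the singular values of `X`, that is, of the square
roots of the eigenvalues of `Xᴴ X`. -/
def traceNorm (X : Matrix d d ℂ) : ℝ :=
  ∑ i, Real.sqrt ((Matrix.isHermitian_conjTranspose_mul_self X).eigenvalues i)

/-- The trace distance. -/
def traceDist (ρ σ : Matrix d d ℂ) : ℝ :=
  (1 / 2) * traceNorm (ρ - σ)

/-- The von Neumann entropy `-Tr (ρ log₂ ρ)`, in bits, of a Hermitian matrix `ρ`, computed from its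
eigenvalues with the convention `0 log 0 = 0` (and set to `0` if `ρ` is not Hermitian). -/
def entropy (ρ : Matrix d d ℂ) : ℝ :=
  open Classical in
  if h : ρ.IsHermitian then -∑ i, h.eigenvalues i * Real.logb 2 (h.eigenvalues i) else 0

/-- A pure state `|ψ⟩⟨ψ|`, with `ψ` a unit vector. -/
def IsPureState (ρ : Matrix d d ℂ) : Prop :=
  ∃ ψ : d → ℂ, ∑ i, ‖ψ i‖ ^ 2 = 1 ∧ ρ = Matrix.vecMulVec ψ (star ψ)

end Operators

/-! ### Channels -/

section Channels

variable {d : Type*} [Fintype d] [DecidableEq d]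

/-- The Choi matrix `(T ⊗ id)(|Ω⟩⟨Ω|)`, where `Ω = d ^ (-1/2) ∑ a, |a a⟩`, so that
`|Ω⟩⟨Ω| = d⁻¹ ∑ a b, |a⟩⟨b| ⊗ |a⟩⟨b|`. -/
def choi (T : Matrix d d ℂ →ₗ[ℂ] Matrix d d ℂ) : Matrix (d × d) (d × d) ℂ :=
  (Fintype.card d : ℂ)⁻¹ • ∑ a, ∑ b,
    Matrix.kroneckerMap (· * ·) (T (Matrix.single a b 1)) (Matrix.single a b 1)

/-- The `n`-fold tensor power `Φ^{⊗n}`, acting on matrices indexed by `n`-tuples of basis labels. It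
sends the matrix unit `⨂ₘ |kₘ⟩⟨lₘ|` to `⨂ₘ Φ(|kₘ⟩⟨lₘ|)`. -/
def tensorPower (n : ℕ) (Φ : Matrix d d ℂ →ₗ[ℂ] Matrix d d ℂ) :
    Matrix (Fin n → d) (Fin n → d) ℂ →ₗ[ℂ] Matrix (Fin n → d) (Fin n → d) ℂ where
  toFun X := Matrix.of fun i j => ∑ k, ∑ l,
    X k l * ∏ m, Φ (Matrix.single (k m) (l m) 1) (i m) (j m)
  map_add' X Y := by
    ext i j
    simp [add_mul, Finset.sum_add_distrib]
  map_smul' c X := by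
    ext i j
    simp [Finset.mul_sum, mul_assoc]

/-- The tensor power acts factorwise on product operators `⨂ₘ Aₘ`. -/
theorem tensorPower_prod (n : ℕ) (Φ : Matrix d d ℂ →ₗ[ℂ] Matrix d d ℂ)
    (A : Fin n → Matrix d d ℂ) :
    tensorPower n Φ (Matrix.of fun i j => ∏ m, A m (i m) (j m)) =
      Matrix.of fun i j => ∏ m, Φ (A m) (i m) (j m) := by
  ext i j
  have h : ∀ B : Matrix d d ℂ, ∀ x y,
      Φ B x y = ∑ a, ∑ b, B a b * Φ (Matrix.single a b 1) x y := by
    intro B x y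
    conv_lhs => rw [Matrix.matrix_eq_sum_single B]
    simp only [map_sum, Matrix.sum_apply]
    refine Finset.sum_congr rfl fun a _ => Finset.sum_congr rfl fun b _ => ?_
    have : Matrix.single a b (B a b) = B a b • Matrix.single a b (1 : ℂ) := by
      simp [Matrix.smul_single]
    rw [this, map_smul, Matrix.smul_apply, smul_eq_mul]
  simp only [tensorPower, LinearMap.coe_mk, AddHom.coe_mk, Matrix.of_apply, ← Finset.prod_mul_distrib]
  simp_rw [h (A _)]
  rw [Finset.prod_univ_sum, Fintype.piFinset_univ]
  refine Finset.sum_congr rfl fun k _ => ?_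
  rw [Finset.prod_univ_sum, Fintype.piFinset_univ]

/-- The single-qubit depolarizing map `ρ ↦ (1 - p) ρ + p (Tr ρ) I / 2`. -/
def depol (p : ℝ) : Matrix (Fin 2) (Fin 2) ℂ →ₗ[ℂ] Matrix (Fin 2) (Fin 2) ℂ :=
  (1 - (p : ℂ)) • LinearMap.id +
    ((p : ℂ) / 2) • (Matrix.traceLinearMap (Fin 2) ℂ ℂ).smulRight 1

end Channels

/-! ### Random states -/

/-- The (product, equivalently Borel) sigma-algebra on complex matrices. -/
instance matrixMeasurableSpace {m n : Type*} : MeasurableSpace (Matrix m n ℂ) :=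
  inferInstanceAs (MeasurableSpace (m → n → ℂ))

instance matrixBorelSpace {m n : Type*} [Finite m] [Finite n] : BorelSpace (Matrix m n ℂ) :=
  inferInstanceAs (BorelSpace (m → n → ℂ))

section Random

variable {d : Type*} [Fintype d] [DecidableEq d]

instance unitaryCompactSpace : CompactSpace (Matrix.unitaryGroup d ℂ) := by
  refine (isCompact_iff_compactSpace (X := Matrix d d ℂ)).mp (?_ : IsCompact (Matrix.unitaryGroup d ℂ : Set (Matrix d d ℂ)))
  have hc : IsCompact (Set.pi Set.univ fun _ : d => Set.pi Set.univ fun _ : d =>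
      Metric.closedBall (0 : ℂ) 1) :=
    isCompact_univ_pi fun _ => isCompact_univ_pi fun _ => isCompact_closedBall _ _
  refine hc.of_isClosed_subset (isClosed_unitary (R := Matrix d d ℂ)) ?_
  intro U hU i _ j _
  simpa using entry_norm_bound_of_unitary hU i j

/-- The Haar probability measure on the unitary group `U(d)`. -/
def haarUnitary (d : Type*) [Fintype d] [DecidableEq d] :
    Measure (Matrix.unitaryGroup d ℂ) :=
  Measure.haarMeasure ⊤

/-- `μ` is a state `t`-design: a probability distribution on pure states under which every polynomial
of bidegree `(t, t)` in the components of the state vector and their conjugates (equivalently, every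
entry of `ρ^{⊗t}`) has the same expectation as under the uniform distribution, the law of `U ρ₀ Uᴴ`
for a fixed pure state `ρ₀` and a Haar distributed unitary `U`. -/
structure IsStateDesign (t : ℕ) (μ : Measure (Matrix d d ℂ)) : Prop where
  prob : IsProbabilityMeasure μ
  pure : ∀ᵐ ρ ∂μ, IsPureState ρ
  moments : ∃ ρ₀ : Matrix d d ℂ, IsPureState ρ₀ ∧ ∀ i j : Fin t → d,
    ∫ ρ, ∏ k, ρ (i k) (j k) ∂μ =
      ∫ U : Matrix.unitaryGroup d ℂ,
        ∏ k, ((U : Matrix d d ℂ) * ρ₀ * (U : Matrix d d ℂ).conjTranspose) (i k) (j k)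
        ∂(haarUnitary d)

/-- The `q`-th moment of contraction of the trace distance under `T` for a distribution `ν` of pairs
of states; `q = 1` is the average contraction. A pair with `ρ = σ` contributes the value `0 / 0 = 0`. -/
def traceContraction (q : ℝ) (T : Matrix d d ℂ →ₗ[ℂ] Matrix d d ℂ)
    (ν : Measure (Matrix d d ℂ × Matrix d d ℂ)) : ℝ :=
  (∫ x, (traceDist (T x.1) (T x.2) / traceDist x.1 x.2) ^ q ∂ν) ^ (1 / q)

/-- The law of two independent `μ`-distributed states, conditioned on their being different. It is
`μ × μ` itself if two independent states are almost surely different. -/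
def distinctPairs (μ : Measure (Matrix d d ℂ)) : Measure (Matrix d d ℂ × Matrix d d ℂ) :=
  ProbabilityTheory.cond (μ.prod μ) {x | x.1 ≠ x.2}

end Random

end QContraction

end

/-!
Write `D = 2 ^ n`, `T = T_p^{⊗n}` and `q = 1 - p`. The depolarizing channel is a mixture of the
identity and the three Pauli matrices, with the eigenvalues of its Choi state as probabilities, so
`T` is a mixture of Pauli strings (`tensorPower_depol`). In particular it does not increase the
trace norm of Hermitian matrices, and the contraction ratio of a pair of pure states is at most one.

*Small noise.* If `S(τ_p) < 1`, a set `A` of exponentially fewer than `D` Pauli strings carries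
almost all of the probability (`exists_typical`). For a pure state `ρ = |ψ⟩⟨ψ|`, the projection onto
the span of the vectors `Pₖ ψ`, `k ∈ A`, accepts `T ρ` with probability close to one. Its rank is at
most `|A|`, and `T σ` is on average maximally mixed for an independent `σ`, so it accepts `T σ` with
probability at most `|A| / D` on average. The two outputs therefore become orthogonal
(`IsStateDesign.le_integral_contractionRatio`). Only the first moment of the design matters here.

*Large noise.* On a space of dimension `D`, `‖X‖₁ ≤ √D ‖X‖₂`. The second moment of a 2-design is
`(I + F) / (D (D + 1))` with `F` the flip (`haarMoment_eq`; it is computed from the invariance of the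
Haar measure under diagonal phases and Hadamard rotations). Hence `D 𝔼 ‖T (ρ - σ)‖₂²` is at most
`2 ((1 + 3 q²) / 2) ^ n`, which tends to zero exactly when `q² < 1 / 3`. As independent states
have small overlap, the denominator of the ratio is bounded below outside an event of small
probability (`IsStateDesign.integral_contractionRatio_le`).

*Conditioning on distinct states.* A pair of equal states contributes zero to the average, so the
conditioning divides it by the probability of distinct states, which is at least the average itself
and at least `1 - 1 / D`.

*The threshold.* The entropy of the Choi state is strictly concave on `[0, 4 / 3]`, smaller than one
bit at `1 / 4` and larger than one bit at `16 / 63` and at `4 / 3`, so it takes the value one exactly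
once, and is smaller to the left (`exists_threshold`).
-/

noncomputable section

namespace QContraction

/-! ### The trace norm -/

section TraceNorm

variable {d : Type*} [Fintype d] [DecidableEq d]

theorem exists_diagonalization {A : Matrix d d ℂ} (hA : A.IsHermitian) :
    ∃ V : Matrix d d ℂ, V * V.conjTranspose = 1 ∧ V.conjTranspose * V = 1 ∧
      A = V * Matrix.diagonal (fun i => (hA.eigenvalues i : ℂ)) * V.conjTranspose := by
  refine ⟨hA.eigenvectorUnitary, ?_, ?_, ?_⟩
  · exact (Matrix.mem_unitaryGroup_iff).1 hA.eigenvectorUnitary.2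
  · exact (Matrix.mem_unitaryGroup_iff').1 hA.eigenvectorUnitary.2
  · have h := hA.spectral_theorem
    rw [Unitary.conjStarAlgAut_apply] at h
    exact h

/-- Sums over the eigenvalues of a Hermitian matrix may be computed in any unitary
diagonalization. -/
theorem sum_eigenvalues_eq {A : Matrix d d ℂ} (hA : A.IsHermitian) {V : Matrix d d ℂ}
    (hV : V.conjTranspose * V = 1) {x : d → ℝ}
    (h : A = V * Matrix.diagonal (fun i => (x i : ℂ)) * V.conjTranspose) (f : ℝ → ℝ) :
    ∑ i, f (hA.eigenvalues i) = ∑ i, f (x i) := by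
  have h1 : A.charpoly = ∏ i, (Polynomial.X - Polynomial.C (x i : ℂ)) := by
    rw [h, Matrix.charpoly_mul_comm, ← mul_assoc, hV, one_mul, Matrix.charpoly_diagonal]
  have h2 := hA.roots_charpoly_eq_eigenvalues
  rw [h1, Polynomial.roots_prod _ _ (Finset.prod_ne_zero_iff.2 fun i _ =>
    Polynomial.X_sub_C_ne_zero _)] at h2
  simp only [Polynomial.roots_X_sub_C, Multiset.bind_singleton] at h2
  have h3 := congrArg (fun s : Multiset ℂ => (s.map fun z => f z.re).sum) h2
  simp only [Multiset.map_map, Function.comp_def] at h3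
  simpa using h3.symm

theorem traceNorm_nonneg (X : Matrix d d ℂ) : 0 ≤ traceNorm X :=
  Finset.sum_nonneg fun _ _ => Real.sqrt_nonneg _

open scoped ComplexOrder in
theorem eigenvalues_conjTranspose_mul_self_nonneg (X : Matrix d d ℂ) (i : d) :
    0 ≤ (Matrix.isHermitian_conjTranspose_mul_self X).eigenvalues i :=
  (Matrix.posSemidef_conjTranspose_mul_self X).eigenvalues_nonneg i

theorem re_trace_conjTranspose_mul_self (X : Matrix d d ℂ) :
    (X.conjTranspose * X).trace.re =
      ∑ i, (Matrix.isHermitian_conjTranspose_mul_self X).eigenvalues i := by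
  rw [(Matrix.isHermitian_conjTranspose_mul_self X).trace_eq_sum_eigenvalues]
  simp

/-- One half of the duality between the trace norm and the operator norm. -/
theorem re_trace_mul_le_traceNorm {M : Matrix d d ℂ} (hM : M * M.conjTranspose = 1)
    (X : Matrix d d ℂ) : (M * X).trace.re ≤ traceNorm X := by
  obtain ⟨V, hV, hV', h⟩ :=
    exists_diagonalization (Matrix.isHermitian_conjTranspose_mul_self X)
  set l := (Matrix.isHermitian_conjTranspose_mul_self X).eigenvalues with hl
  set P := V.conjTranspose * M with hP
  set Q := X * V with hQ
  have hPP : P * P.conjTranspose = 1 := by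
    rw [hP, Matrix.conjTranspose_mul, Matrix.conjTranspose_conjTranspose,
      Matrix.mul_assoc, ← Matrix.mul_assoc M, hM, one_mul, hV']
  have hQQ : Q.conjTranspose * Q = Matrix.diagonal (fun i => (l i : ℂ)) := by
    calc Q.conjTranspose * Q = V.conjTranspose * (X.conjTranspose * X) * V := by
          rw [hQ, Matrix.conjTranspose_mul]; simp only [Matrix.mul_assoc]
      _ = (V.conjTranspose * V) * Matrix.diagonal (fun i => (l i : ℂ)) *
          (V.conjTranspose * V) := by rw [h]; simp only [Matrix.mul_assoc]
      _ = _ := by rw [hV']; simp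
  have hp : ∀ i, ∑ j, ‖P i j‖ ^ 2 = 1 := by
    intro i
    have := congrFun (congrFun hPP i) i
    rw [Matrix.mul_apply] at this
    simp only [Matrix.conjTranspose_apply, Matrix.one_apply_eq, RCLike.star_def,
      Complex.mul_conj'] at this
    exact_mod_cast this
  have hq : ∀ i, ∑ j, ‖Q j i‖ ^ 2 = l i := by
    intro i
    have := congrFun (congrFun hQQ i) i
    rw [Matrix.mul_apply] at this
    simp only [Matrix.conjTranspose_apply, Matrix.diagonal_apply_eq, RCLike.star_def,
      Complex.conj_mul'] at this
    exact_mod_cast this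
  have htr : (M * X).trace = ∑ i, ∑ j, P i j * Q j i := by
    have : (P * Q).trace = (M * X).trace := by
      rw [hP, hQ, Matrix.mul_assoc, Matrix.trace_mul_comm, Matrix.mul_assoc, Matrix.mul_assoc, hV,
        mul_one]
    rw [← this]; rfl
  calc (M * X).trace.re ≤ ‖(M * X).trace‖ := Complex.re_le_norm _
    _ ≤ ∑ i, ∑ j, ‖P i j‖ * ‖Q j i‖ := by
        rw [htr]
        refine (norm_sum_le _ _).trans (Finset.sum_le_sum fun i _ => ?_)
        refine (norm_sum_le _ _).trans (Finset.sum_le_sum fun j _ => ?_)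
        rw [norm_mul]
    _ ≤ ∑ i, Real.sqrt (l i) := by
        refine Finset.sum_le_sum fun i _ => ?_
        have := Real.sum_mul_le_sqrt_mul_sqrt Finset.univ (fun j => ‖P i j‖) fun j => ‖Q j i‖
        rwa [hp, hq, Real.sqrt_one, one_mul] at this
    _ = traceNorm X := rfl

/-- The trace norm of a Hermitian matrix `X` is `Tr (W X)` for the unitary `W = sign X`. -/
theorem exists_unitary_trace_mul_eq_traceNorm {X : Matrix d d ℂ} (hX : X.IsHermitian) :
    ∃ W : Matrix d d ℂ, W * W.conjTranspose = 1 ∧ W.conjTranspose * W = 1 ∧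
      (W * X).trace.re = traceNorm X := by
  obtain ⟨V, hV, hV', h⟩ := exists_diagonalization hX
  set x := hX.eigenvalues with hx
  set s : d → ℂ := fun i => if 0 ≤ x i then 1 else -1 with hs
  have hss : Matrix.diagonal s * Matrix.diagonal s = (1 : Matrix d d ℂ) := by
    rw [Matrix.diagonal_mul_diagonal, ← Matrix.diagonal_one]
    congr 1; ext i; simp only [hs]; split_ifs <;> simp
  have hsh : (Matrix.diagonal s).conjTranspose = Matrix.diagonal s := by
    rw [Matrix.diagonal_conjTranspose]
    congr 1; ext i; simp only [hs, Pi.star_apply]; split_ifs <;> simp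
  have hWh : (V * Matrix.diagonal s * V.conjTranspose).conjTranspose =
      V * Matrix.diagonal s * V.conjTranspose := by
    simp only [Matrix.conjTranspose_mul, Matrix.conjTranspose_conjTranspose, hsh, Matrix.mul_assoc]
  have hmul : ∀ A B : Matrix d d ℂ, (V * A * V.conjTranspose) * (V * B * V.conjTranspose) =
      V * (A * B) * V.conjTranspose := by
    intro A B
    calc _ = V * A * (V.conjTranspose * V) * B * V.conjTranspose := by
          simp only [Matrix.mul_assoc]
      _ = _ := by rw [hV', mul_one, Matrix.mul_assoc V A B]
  have hWW : (V * Matrix.diagonal s * V.conjTranspose) *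
      (V * Matrix.diagonal s * V.conjTranspose) = 1 := by
    rw [hmul, hss, mul_one, hV]
  refine ⟨V * Matrix.diagonal s * V.conjTranspose, by rw [hWh, hWW], by rw [hWh, hWW], ?_⟩
  have habs : ∑ i, |x i| = traceNorm X := by
    have hsq : X.conjTranspose * X =
        V * Matrix.diagonal (fun i => ((x i ^ 2 : ℝ) : ℂ)) * V.conjTranspose := by
      rw [hX.eq]
      conv_lhs => rw [h]
      rw [hmul, Matrix.diagonal_mul_diagonal]
      simp only [Complex.ofReal_mul, sq]
    have := sum_eigenvalues_eq (Matrix.isHermitian_conjTranspose_mul_self X) hV' hsq Real.sqrt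
    rw [traceNorm, this]
    exact Finset.sum_congr rfl fun i _ => (Real.sqrt_sq_eq_abs _).symm
  rw [← habs]
  conv_lhs => rw [h]
  rw [hmul, Matrix.trace_mul_comm, ← Matrix.mul_assoc, hV', one_mul,
    Matrix.diagonal_mul_diagonal, Matrix.trace_diagonal, Complex.re_sum]
  refine Finset.sum_congr rfl fun i _ => ?_
  simp only [hs]
  split_ifs with h0
  · simp [abs_of_nonneg h0]
  · simp [abs_of_neg (not_le.1 h0)]

/-- The bound `‖X‖₁ ≤ √D ‖X‖₂` in dimension `D`, linearized by the inequality of arithmetic and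
geometric means. -/
theorem traceNorm_le_add (X : Matrix d d ℂ) {ε : ℝ} (hε : 0 < ε) [Nonempty d] :
    traceNorm X ≤ ε + Fintype.card d / (4 * ε) * (X.conjTranspose * X).trace.re := by
  have hc : (0 : ℝ) < Fintype.card d := by exact_mod_cast Fintype.card_pos
  have h : ∀ l : ℝ, 0 ≤ l →
      Real.sqrt l ≤ ε / Fintype.card d + Fintype.card d / (4 * ε) * l := by
    intro l hl
    obtain ⟨y, hy, rfl⟩ : ∃ y : ℝ, 0 ≤ y ∧ l = y ^ 2 :=
      ⟨Real.sqrt l, Real.sqrt_nonneg _, (Real.sq_sqrt hl).symm⟩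
    rw [Real.sqrt_sq hy, ← sub_nonneg]
    have : ε / Fintype.card d + Fintype.card d / (4 * ε) * y ^ 2 - y =
        (2 * ε - Fintype.card d * y) ^ 2 / (4 * ε * Fintype.card d) := by
      field_simp; ring
    rw [this]; positivity
  calc traceNorm X ≤ ∑ i, (ε / Fintype.card d + Fintype.card d / (4 * ε) *
        (Matrix.isHermitian_conjTranspose_mul_self X).eigenvalues i) :=
        Finset.sum_le_sum fun i _ => h _ (eigenvalues_conjTranspose_mul_self_nonneg X i)
    _ = _ := by
        rw [Finset.sum_add_distrib, ← Finset.mul_sum, re_trace_conjTranspose_mul_self]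
        simp only [Finset.sum_const, Finset.card_univ, nsmul_eq_mul]
        field_simp

/-- The trace norm dominates the Hilbert-Schmidt norm. -/
theorem re_trace_conjTranspose_mul_self_le (X : Matrix d d ℂ) :
    (X.conjTranspose * X).trace.re ≤ traceNorm X ^ 2 := by
  rw [re_trace_conjTranspose_mul_self]
  calc _ = ∑ i, Real.sqrt ((Matrix.isHermitian_conjTranspose_mul_self X).eigenvalues i) ^ 2 :=
        Finset.sum_congr rfl fun i _ =>
          (Real.sq_sqrt (eigenvalues_conjTranspose_mul_self_nonneg X i)).symm
    _ ≤ _ := Finset.sum_sq_le_sq_sum_of_nonneg fun i _ => Real.sqrt_nonneg _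

theorem entry_norm_le_one {W : Matrix d d ℂ} (hW : W * W.conjTranspose = 1) (i j : d) :
    ‖W i j‖ ≤ 1 :=
  entry_norm_bound_of_unitary ((Matrix.mem_unitaryGroup_iff).2 hW) i j

theorem traceNorm_le_sum_norm {X : Matrix d d ℂ} (hX : X.IsHermitian) :
    traceNorm X ≤ ∑ i, ∑ j, ‖X i j‖ := by
  obtain ⟨W, hW, -, h⟩ := exists_unitary_trace_mul_eq_traceNorm hX
  rw [← h, Matrix.trace_mul_comm]
  refine (Complex.re_le_norm _).trans ?_
  simp only [Matrix.trace, Matrix.diag_apply, Matrix.mul_apply]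
  refine (norm_sum_le _ _).trans (Finset.sum_le_sum fun i _ => ?_)
  refine (norm_sum_le _ _).trans (Finset.sum_le_sum fun j _ => ?_)
  rw [norm_mul]
  exact mul_le_of_le_one_right (norm_nonneg _) (entry_norm_le_one hW _ _)

theorem traceNorm_le_traceNorm_add {X Y : Matrix d d ℂ} (hX : X.IsHermitian) :
    traceNorm X ≤ traceNorm Y + traceNorm (X - Y) := by
  obtain ⟨W, hW, -, h⟩ := exists_unitary_trace_mul_eq_traceNorm hX
  rw [← h, show W * X = W * Y + W * (X - Y) by rw [← mul_add, add_sub_cancel], Matrix.trace_add,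
    Complex.add_re]
  exact add_le_add (re_trace_mul_le_traceNorm hW _) (re_trace_mul_le_traceNorm hW _)

/-- The trace norm is continuous on Hermitian matrices; composing with the projection onto the
Hermitian part makes this a statement about all matrices. -/
theorem continuous_traceNorm_hermitianPart :
    Continuous fun X : Matrix d d ℂ => traceNorm ((1 / 2 : ℂ) • (X + X.conjTranspose)) := by
  set H : Matrix d d ℂ → Matrix d d ℂ := fun X => (1 / 2 : ℂ) • (X + X.conjTranspose) with hH
  have hherm : ∀ X, (H X).IsHermitian := by
    intro X
    simp only [hH, Matrix.IsHermitian, Matrix.conjTranspose_smul, Matrix.conjTranspose_add,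
      Matrix.conjTranspose_conjTranspose]
    rw [add_comm]; congr 1; simp
  have hcont : Continuous H := by
    simp only [hH]; fun_prop
  have hbound : ∀ X Y, |traceNorm (H X) - traceNorm (H Y)| ≤ ∑ i, ∑ j, ‖H X i j - H Y i j‖ := by
    have key : ∀ X Y, traceNorm (H X) - traceNorm (H Y) ≤ ∑ i, ∑ j, ‖H X i j - H Y i j‖ := by
      intro X Y
      have h1 := traceNorm_le_traceNorm_add (Y := H Y) (hherm X)
      have h2 := traceNorm_le_sum_norm ((hherm X).sub (hherm Y))
      simp only [Matrix.sub_apply] at h2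
      linarith
    intro X Y
    refine abs_sub_le_iff.2 ⟨key X Y, (key Y X).trans_eq ?_⟩
    exact Finset.sum_congr rfl fun i _ => Finset.sum_congr rfl fun j _ => norm_sub_rev _ _
  refine continuous_iff_continuousAt.2 fun Y => ?_
  rw [ContinuousAt, tendsto_iff_norm_sub_tendsto_zero]
  refine squeeze_zero (fun _ => norm_nonneg _) (fun X => hbound X Y) ?_
  have hc : Continuous fun X => ∑ i, ∑ j, ‖H X i j - H Y i j‖ :=
    continuous_finsetSum _ fun i _ => continuous_finsetSum _ fun j _ =>
      ((hcont.matrix_elem i j).sub continuous_const).norm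
  have := hc.tendsto Y
  simpa using this

end TraceNorm

theorem hermitianPart_eq {d : Type*} {X : Matrix d d ℂ} (hX : X.IsHermitian) :
    (1 / 2 : ℂ) • (X + X.conjTranspose) = X := by
  rw [hX.eq, ← two_smul ℂ X, smul_smul]; norm_num

/-! ### Pure states -/

section PureStates

variable {d : Type*} [Fintype d]

/-- The tensor square of a pure state is invariant under the flip. -/
theorem IsPureState.mul_comm_entries {ρ : Matrix d d ℂ} (h : IsPureState ρ) (i j k l : d) :
    ρ i j * ρ k l = ρ i l * ρ k j := by
  obtain ⟨ψ, -, rfl⟩ := h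
  simp only [Matrix.vecMulVec_apply]; ring

theorem IsPureState.trace_eq_one {ρ : Matrix d d ℂ} (h : IsPureState ρ) : ρ.trace = 1 := by
  obtain ⟨ψ, hψ, rfl⟩ := h
  simp only [Matrix.trace, Matrix.diag_apply, Matrix.vecMulVec_apply, Pi.star_apply,
    RCLike.star_def, Complex.mul_conj']
  exact_mod_cast hψ

theorem IsPureState.isHermitian {ρ : Matrix d d ℂ} (h : IsPureState ρ) : ρ.IsHermitian := by
  obtain ⟨ψ, -, rfl⟩ := h
  ext i j
  simp [Matrix.vecMulVec_apply, mul_comm]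

theorem IsPureState.norm_entry_le_one {ρ : Matrix d d ℂ} (h : IsPureState ρ) (i j : d) :
    ‖ρ i j‖ ≤ 1 := by
  obtain ⟨ψ, hψ, rfl⟩ := h
  have hle : ∀ i, ‖ψ i‖ ≤ 1 := by
    intro i
    have h1 : ‖ψ i‖ ^ 2 ≤ 1 := by
      rw [← hψ]
      exact Finset.single_le_sum (f := fun i => ‖ψ i‖ ^ 2) (fun _ _ => by positivity)
        (Finset.mem_univ i)
    nlinarith [norm_nonneg (ψ i)]
  simp only [Matrix.vecMulVec_apply, Pi.star_apply, norm_mul, norm_star]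
  exact mul_le_one₀ (hle i) (norm_nonneg _) (hle j)

theorem IsPureState.conj [DecidableEq d] {ρ : Matrix d d ℂ} (h : IsPureState ρ) {V : Matrix d d ℂ}
    (hV : V.conjTranspose * V = 1) : IsPureState (V * ρ * V.conjTranspose) := by
  have ht : (V * ρ * V.conjTranspose).trace = 1 := by
    rw [Matrix.trace_mul_comm, ← Matrix.mul_assoc, hV, one_mul, h.trace_eq_one]
  obtain ⟨ψ, hψ, rfl⟩ := h
  have he : V * Matrix.vecMulVec ψ (star ψ) * V.conjTranspose =
      Matrix.vecMulVec (V.mulVec ψ) (star (V.mulVec ψ)) := by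
    rw [Matrix.mul_vecMulVec, Matrix.vecMulVec_mul, Matrix.star_mulVec]
  rw [he] at ht ⊢
  refine ⟨V.mulVec ψ, ?_, rfl⟩
  simp only [Matrix.trace, Matrix.diag_apply, Matrix.vecMulVec_apply, Pi.star_apply,
    RCLike.star_def, Complex.mul_conj'] at ht
  exact_mod_cast ht

end PureStates

theorem measurable_entry {d : Type*} (i j : d) : Measurable fun ρ : Matrix d d ℂ => ρ i j :=
  (measurable_pi_apply j).comp (measurable_pi_apply (X := fun _ : d => d → ℂ) i)

/-! ### Second moments of the uniform distribution on pure states -/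

section Haar

variable {d : Type*} [Fintype d] [DecidableEq d]

instance isProbabilityMeasure_haarUnitary : IsProbabilityMeasure (haarUnitary d) :=
  ⟨by simpa [haarUnitary] using
    Measure.haarMeasure_self (K₀ := (⊤ : TopologicalSpace.PositiveCompacts
      (Matrix.unitaryGroup d ℂ)))⟩

instance isMulLeftInvariant_haarUnitary : (haarUnitary d).IsMulLeftInvariant :=
  inferInstanceAs (Measure.haarMeasure _).IsMulLeftInvariant

/-- The random pure state `U ρ₀ Uᴴ`. -/
def orbit (ρ₀ : Matrix d d ℂ) (U : Matrix.unitaryGroup d ℂ) : Matrix d d ℂ :=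
  (U : Matrix d d ℂ) * ρ₀ * (U : Matrix d d ℂ).conjTranspose

/-- The second moments `𝔼[ρᵢⱼ ρₖₗ]` of `ρ = U ρ₀ Uᴴ` for a Haar distributed `U`. -/
def haarMoment (ρ₀ : Matrix d d ℂ) (i j k l : d) : ℂ :=
  ∫ U, orbit ρ₀ U i j * orbit ρ₀ U k l ∂(haarUnitary d)

/-- The law of `U ρ₀ Uᴴ` is invariant under conjugation by unitaries. -/
theorem integral_orbit_conj (ρ₀ : Matrix d d ℂ) {V : Matrix d d ℂ}
    (hV : V * V.conjTranspose = 1) (F : Matrix d d ℂ → ℂ) :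
    ∫ U, F (V * orbit ρ₀ U * V.conjTranspose) ∂(haarUnitary d) =
      ∫ U, F (orbit ρ₀ U) ∂(haarUnitary d) := by
  have hV' : V ∈ Matrix.unitaryGroup d ℂ := Matrix.mem_unitaryGroup_iff.2 hV
  rw [← integral_mul_left_eq_self (μ := haarUnitary d) (fun U => F (orbit ρ₀ U)) ⟨V, hV'⟩]
  congr 1; ext U; congr 1
  simp only [orbit, Submonoid.coe_mul, Matrix.conjTranspose_mul, Matrix.mul_assoc]

theorem continuous_orbit (ρ₀ : Matrix d d ℂ) : Continuous (orbit ρ₀) := by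
  unfold orbit; fun_prop

theorem integrable_orbit_mul (ρ₀ : Matrix d d ℂ) (i j k l : d) :
    Integrable (fun U => orbit ρ₀ U i j * orbit ρ₀ U k l) (haarUnitary d) := by
  have hc : Continuous fun U => orbit ρ₀ U i j * orbit ρ₀ U k l :=
    ((continuous_orbit ρ₀).matrix_elem i j).mul ((continuous_orbit ρ₀).matrix_elem k l)
  exact hc.integrable_of_hasCompactSupport (HasCompactSupport.of_compactSpace _)

theorem isPureState_orbit {ρ₀ : Matrix d d ℂ} (h : IsPureState ρ₀)
    (U : Matrix.unitaryGroup d ℂ) : IsPureState (orbit ρ₀ U) :=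
  h.conj ((Matrix.mem_unitaryGroup_iff').1 U.2)

theorem haarMoment_comm {ρ₀ : Matrix d d ℂ} (h : IsPureState ρ₀) (i j k l : d) :
    haarMoment ρ₀ i j k l = haarMoment ρ₀ i l k j := by
  unfold haarMoment
  congr 1; ext U; exact (isPureState_orbit h U).mul_comm_entries i j k l

/-- Invariance under the phase gate `diag(1, …, i, …, 1)`: a moment vanishes unless every basis
label occurs as often among the row labels as among the column labels. -/
theorem haarMoment_phase (ρ₀ : Matrix d d ℂ) (x i j k l : d) :
    haarMoment ρ₀ i j k l =
      ((if i = x then Complex.I else 1) * (if j = x then -Complex.I else 1) *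
        (if k = x then Complex.I else 1) * (if l = x then -Complex.I else 1)) *
        haarMoment ρ₀ i j k l := by
  set v : d → ℂ := fun i => if i = x then Complex.I else 1 with hv
  have hV : Matrix.diagonal v * (Matrix.diagonal v).conjTranspose = 1 := by
    rw [Matrix.diagonal_conjTranspose, Matrix.diagonal_mul_diagonal, ← Matrix.diagonal_one]
    congr 1; ext i; simp only [hv, Pi.star_apply]; split_ifs <;> simp
  have h := integral_orbit_conj ρ₀ hV (fun R => R i j * R k l)
  unfold haarMoment
  conv_lhs => rw [← h]
  rw [← integral_const_mul]
  congr 1; ext U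
  have hs : ∀ j, star (v j) = if j = x then -Complex.I else 1 := by
    intro j; simp only [hv]; split_ifs <;> simp
  simp only [Matrix.diagonal_conjTranspose, Matrix.mul_diagonal, Matrix.diagonal_mul,
    Pi.star_apply, hs]
  simp only [hv]
  ring

/-- The only moments that survive all phases are those paired by the identity or by the flip. -/
theorem haarMoment_eq_zero {ρ₀ : Matrix d d ℂ} {i j k l : d}
    (h1 : ¬ (i = j ∧ k = l)) (h2 : ¬ (i = l ∧ k = j)) : haarMoment ρ₀ i j k l = 0 := by
  have hI : (Complex.I : ℂ) ≠ 1 := by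
    intro h; simpa using congrArg Complex.re h
  have hI' : (-Complex.I : ℂ) ≠ 1 := by
    intro h; simpa using congrArg Complex.re h
  have hm : (-1 : ℂ) ≠ 1 := by norm_num
  have key : ∀ c : ℂ, c ≠ 1 → haarMoment ρ₀ i j k l = c * haarMoment ρ₀ i j k l →
      haarMoment ρ₀ i j k l = 0 := by
    intro c hc h
    have : (1 - c) * haarMoment ρ₀ i j k l = 0 := by rw [sub_mul, one_mul, ← h, sub_self]
    exact (mul_eq_zero.1 this).resolve_left (sub_ne_zero.2 (Ne.symm hc))
  have hi := haarMoment_phase ρ₀ i i j k l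
  have hk := haarMoment_phase ρ₀ k i j k l
  by_cases hij : j = i
  · subst hij
    have hkl : l ≠ k := fun h => h1 ⟨rfl, h.symm⟩
    by_cases hjk : j = k
    · subst hjk
      refine key _ ?_ hk
      simp [hkl, hI]
    · refine key _ ?_ hk
      simp [hkl, hjk, hI]
  · by_cases hil : l = i
    · subst hil
      have hkj : j ≠ k := fun h => h2 ⟨rfl, h.symm⟩
      by_cases hlk : l = k
      · subst hlk
        refine key _ ?_ hk
        simp [hkj, hI]
      · refine key _ ?_ hk
        simp [hkj, hlk, hI]
    · refine key _ ?_ hi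
      by_cases hki : k = i
      · simp [hij, hil, hki, hm]
      · simp [hij, hil, hki, hI]

/-- Invariance under a Hadamard rotation of the basis vectors `x` and `y`. -/
theorem haarMoment_hadamard {ρ₀ : Matrix d d ℂ} (h : IsPureState ρ₀) {x y : d} (hxy : x ≠ y) :
    haarMoment ρ₀ x x x x =
        (haarMoment ρ₀ x x x x + haarMoment ρ₀ y y y y + 4 * haarMoment ρ₀ x x y y) / 4 ∧
      haarMoment ρ₀ y y y y =
        (haarMoment ρ₀ x x x x + haarMoment ρ₀ y y y y + 4 * haarMoment ρ₀ x x y y) / 4 := by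
  set c : ℂ := (((Real.sqrt 2)⁻¹ : ℝ) : ℂ) with hc
  have hcc : c * c = 1 / 2 := by
    rw [hc, ← Complex.ofReal_mul, ← mul_inv, Real.mul_self_sqrt (by norm_num)]
    norm_num
  have hcs : star c = c := by rw [hc]; exact Complex.conj_ofReal _
  set A : Matrix d d ℂ := Matrix.single x x 1 with hA
  set B : Matrix d d ℂ := Matrix.single y y 1 with hB
  set C : Matrix d d ℂ := Matrix.single x y 1 with hC
  set D : Matrix d d ℂ := Matrix.single y x 1 with hD
  have hyx := hxy.symm
  have mAA : A * A = A := by simp [hA]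
  have mAB : A * B = 0 := by simp [hA, hB, hxy]
  have mAC : A * C = C := by simp [hA, hC]
  have mAD : A * D = 0 := by simp [hA, hD, hxy]
  have mBA : B * A = 0 := by simp [hA, hB, hyx]
  have mBB : B * B = B := by simp [hB]
  have mBC : B * C = 0 := by simp [hB, hC, hyx]
  have mBD : B * D = D := by simp [hB, hD]
  have mCA : C * A = 0 := by simp [hA, hC, hyx]
  have mCB : C * B = C := by simp [hB, hC]
  have mCC : C * C = 0 := by simp [hC, hyx]
  have mCD : C * D = A := by simp [hA, hC, hD]
  have mDA : D * A = D := by simp [hA, hD]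
  have mDB : D * B = 0 := by simp [hB, hD, hxy]
  have mDC : D * C = B := by simp [hB, hC, hD]
  have mDD : D * D = 0 := by simp [hD, hxy]
  -- The Hadamard gate on the span of the basis vectors `x` and `y`, the identity on the others.
  set V : Matrix d d ℂ := 1 - A - B + c • (A - B + C + D) with hVdef
  have hVh : V.conjTranspose = V := by
    simp only [hVdef, Matrix.conjTranspose_add, Matrix.conjTranspose_sub, Matrix.conjTranspose_one,
      Matrix.conjTranspose_smul, hcs, hA, hB, hC, hD, Matrix.conjTranspose_single, star_one]
    module
  have hVV : V * V = 1 := by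
    simp only [hVdef, mul_add, add_mul, mul_sub, sub_mul, smul_mul_assoc, mul_smul_comm, one_mul,
      mul_one, smul_add, smul_sub, smul_smul, hcc, mAA, mAB, mAC, mAD, mBA, mBB, mBC, mBD, mCA,
      mCB, mCC, mCD, mDA, mDB, mDC, mDD, smul_zero]
    module
  have hVA : V * A * V = (1 / 2 : ℂ) • (A + B + C + D) := by
    simp only [hVdef, mul_add, add_mul, mul_sub, sub_mul, smul_mul_assoc, mul_smul_comm, one_mul,
      mul_one, smul_add, smul_sub, smul_smul, hcc, mAA, mAB, mAC, mAD, mBA, mCA,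
      mDA, mDB, mDC, mDD, smul_zero, zero_mul]
    module
  have hVB : V * B * V = (1 / 2 : ℂ) • (A + B - C - D) := by
    simp only [hVdef, mul_add, add_mul, mul_sub, sub_mul, smul_mul_assoc, mul_smul_comm, one_mul,
      mul_one, smul_add, smul_sub, smul_smul, hcc, mAB, mBA, mBB, mBC, mBD, mCA,
      mCB, mCC, mCD, mDB, smul_zero, zero_mul]
    module
  have htr : ∀ (a b : d) (R : Matrix d d ℂ), (Matrix.single a b 1 * R).trace = R b a := by
    intro a b R
    simp [Matrix.trace_single_mul]
  have hcyc : ∀ K R : Matrix d d ℂ, (K * (V * R * V)).trace = (V * K * V * R).trace := by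
    intro K R
    rw [show K * (V * R * V) = (K * V * R) * V by simp only [Matrix.mul_assoc],
      Matrix.trace_mul_comm]
    simp only [Matrix.mul_assoc]
  have hx : ∀ R : Matrix d d ℂ, (V * R * V) x x = (R x x + R y y + R x y + R y x) / 2 := by
    intro R
    rw [← htr x x (V * R * V), hcyc, ← hA, hVA]
    simp only [hA, hB, hC, hD, add_mul, smul_mul_assoc, Matrix.trace_add, Matrix.trace_smul, htr,
      smul_eq_mul]
    ring
  have hy : ∀ R : Matrix d d ℂ, (V * R * V) y y = (R x x + R y y - R x y - R y x) / 2 := by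
    intro R
    rw [← htr y y (V * R * V), hcyc, ← hB, hVB]
    simp only [hA, hB, hC, hD, add_mul, sub_mul, smul_mul_assoc, Matrix.trace_add,
      Matrix.trace_sub, Matrix.trace_smul, htr, smul_eq_mul]
    ring
  have hsq : ∀ t : ℂ, t * t = 1 →
      ∫ U, ((orbit ρ₀ U x x + orbit ρ₀ U y y + t * (orbit ρ₀ U x y + orbit ρ₀ U y x)) / 2) ^ 2
        ∂(haarUnitary d) =
      (haarMoment ρ₀ x x x x + haarMoment ρ₀ y y y y + 4 * haarMoment ρ₀ x x y y) / 4 := by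
    intro t ht
    -- The square is a sum of products of two matrix entries, whose expectations are moments.
    have hexp : ∀ U, ((orbit ρ₀ U x x + orbit ρ₀ U y y +
        t * (orbit ρ₀ U x y + orbit ρ₀ U y x)) / 2) ^ 2 =
        ∑ a : Fin 4, ∑ b : Fin 4, ((![1, 1, t, t] a * ![1, 1, t, t] b) / 4) *
          (orbit ρ₀ U (![x, y, x, y] a) (![x, y, y, x] a) *
            orbit ρ₀ U (![x, y, x, y] b) (![x, y, y, x] b)) := by
      intro U
      simp only [Fin.sum_univ_four]
      simp
      ring
    simp only [hexp]
    rw [integral_finsetSum _ fun a _ => integrable_finsetSum _ fun b _ =>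
      (integrable_orbit_mul ρ₀ _ _ _ _).const_mul _]
    simp_rw [integral_finsetSum _ fun b _ => (integrable_orbit_mul ρ₀ _ _ _ _).const_mul _,
      integral_const_mul]
    change ∑ a : Fin 4, ∑ b : Fin 4, ((![1, 1, t, t] a * ![1, 1, t, t] b) / 4) *
      haarMoment ρ₀ (![x, y, x, y] a) (![x, y, y, x] a) (![x, y, x, y] b) (![x, y, y, x] b) = _
    have h1 : haarMoment ρ₀ y y x x = haarMoment ρ₀ x x y y := by
      unfold haarMoment; congr 1; ext U; ring
    have h2 : haarMoment ρ₀ x y y x = haarMoment ρ₀ x x y y := haarMoment_comm h _ _ _ _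
    have h3 : haarMoment ρ₀ y x x y = haarMoment ρ₀ x x y y :=
      (haarMoment_comm h _ _ _ _).trans h1
    simp only [Fin.sum_univ_four]
    simp [h1, h2, h3, ht, haarMoment_eq_zero, hxy, hyx]
    ring
  have hV1 : V * V.conjTranspose = 1 := by rw [hVh, hVV]
  have e1 := integral_orbit_conj ρ₀ hV1 (fun R => R x x ^ 2)
  have e2 := integral_orbit_conj ρ₀ hV1 (fun R => R y y ^ 2)
  simp only [hVh, hx, hy] at e1 e2
  constructor
  · rw [← hsq 1 (by norm_num)]
    simp only [haarMoment, ← sq]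
    rw [← e1]; congr 1; ext U; ring
  · rw [← hsq (-1) (by norm_num)]
    simp only [haarMoment, ← sq]
    rw [← e2]; congr 1; ext U; ring

/-- `𝔼[ρ ⊗ ρ] = (I + F) / (D (D + 1))`, with `F` the flip operator. -/
theorem haarMoment_eq {ρ₀ : Matrix d d ℂ} (h : IsPureState ρ₀) (i j k l : d) :
    haarMoment ρ₀ i j k l =
      ((if i = j ∧ k = l then 1 else 0) + (if i = l ∧ k = j then 1 else 0)) /
        (Fintype.card d * (Fintype.card d + 1)) := by
  have hD : (Fintype.card d : ℂ) ≠ 0 := by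
    have : Nonempty d := ⟨i⟩
    exact_mod_cast Fintype.card_ne_zero
  have hD1 : (Fintype.card d : ℂ) + 1 ≠ 0 := by
    exact_mod_cast Nat.succ_ne_zero (Fintype.card d)
  have hdiag : ∀ x, haarMoment ρ₀ x x x x = haarMoment ρ₀ i i i i := by
    intro x
    by_cases hx : x = i
    · rw [hx]
    · obtain ⟨h1, h2⟩ := haarMoment_hadamard h hx
      exact h1.trans h2.symm
  have hoff : ∀ x y, haarMoment ρ₀ x x y y =
      haarMoment ρ₀ i i i i / 2 + (if x = y then haarMoment ρ₀ i i i i / 2 else 0) := by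
    intro x y
    by_cases hxy : x = y
    · subst hxy; rw [hdiag]; simp
    · obtain ⟨h1, h2⟩ := haarMoment_hadamard h hxy
      rw [hdiag x, hdiag y] at h1
      simp only [hxy, if_false, add_zero]
      linear_combination -h1
  have hsum : ∑ x, ∑ y, haarMoment ρ₀ x x y y = 1 := by
    unfold haarMoment
    simp_rw [← integral_finsetSum _ fun y _ => integrable_orbit_mul ρ₀ _ _ _ _]
    rw [← integral_finsetSum _ fun a _ => integrable_finsetSum _ fun b _ =>
      integrable_orbit_mul ρ₀ _ _ _ _]
    have : ∀ U, ∑ x, ∑ y, orbit ρ₀ U x x * orbit ρ₀ U y y = 1 := by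
      intro U
      rw [← Finset.sum_mul_sum]
      have := (isPureState_orbit h U).trace_eq_one
      simp only [Matrix.trace, Matrix.diag_apply] at this
      rw [this, one_mul]
    simp [this]
  have ha : haarMoment ρ₀ i i i i = 2 / (Fintype.card d * (Fintype.card d + 1)) := by
    have hsum' := (Finset.sum_congr rfl fun x _ => Finset.sum_congr rfl fun y _ =>
      (hoff x y).symm).trans hsum
    simp only [Finset.sum_add_distrib, Finset.sum_const, Finset.card_univ, nsmul_eq_mul,
      Finset.sum_ite_eq, Finset.mem_univ, if_true] at hsum'
    field_simp
    linear_combination 2 * hsum'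
  by_cases h1 : i = j ∧ k = l
  · obtain ⟨rfl, rfl⟩ := h1
    rw [hoff, ha]
    by_cases hik : i = k
    · subst hik; simp; ring
    · simp [hik]; field_simp
  · by_cases h2 : i = l ∧ k = j
    · obtain ⟨rfl, rfl⟩ := h2
      rw [haarMoment_comm h, hoff, ha]
      by_cases hik : i = k
      · subst hik; simp at h1
      · simp [hik]; field_simp
    · rw [haarMoment_eq_zero h1 h2]; simp [h1, h2]

end Haar

/-! ### Moments of a state 2-design -/

section Design

variable {d : Type*} [Fintype d] [DecidableEq d]

variable {μ : Measure (Matrix d d ℂ)}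

theorem IsStateDesign.integrable_entry (hμ : IsStateDesign 2 μ) (i j : d) :
    Integrable (fun ρ => ρ i j) μ := by
  have := hμ.prob
  refine Integrable.of_bound (measurable_entry i j).aestronglyMeasurable 1 ?_
  filter_upwards [hμ.pure] with ρ hρ using hρ.norm_entry_le_one i j

theorem IsStateDesign.integrable_entry_mul (hμ : IsStateDesign 2 μ) (i j k l : d) :
    Integrable (fun ρ => ρ i j * ρ k l) μ := by
  have := hμ.prob
  refine Integrable.of_bound
    ((measurable_entry i j).mul (measurable_entry k l)).aestronglyMeasurable 1 ?_
  filter_upwards [hμ.pure] with ρ hρ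
  rw [norm_mul]
  exact mul_le_one₀ (hρ.norm_entry_le_one i j) (norm_nonneg _) (hρ.norm_entry_le_one k l)

theorem IsStateDesign.integral_entry_mul (hμ : IsStateDesign 2 μ) (i j k l : d) :
    ∫ ρ, ρ i j * ρ k l ∂μ =
      ((if i = j ∧ k = l then 1 else 0) + (if i = l ∧ k = j then 1 else 0)) /
        (Fintype.card d * (Fintype.card d + 1)) := by
  obtain ⟨ρ₀, h₀, h⟩ := hμ.moments
  have := h ![i, k] ![j, l]
  simp only [Fin.prod_univ_two, Matrix.cons_val_zero, Matrix.cons_val_one] at this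
  rw [this]
  exact haarMoment_eq h₀ i j k l

/-- A state 2-design is also a 1-design: the first moments are partial traces of the second ones. -/
theorem IsStateDesign.integral_entry (hμ : IsStateDesign 2 μ) (i j : d) :
    ∫ ρ, ρ i j ∂μ = if i = j then (Fintype.card d : ℂ)⁻¹ else 0 := by
  have hD : (Fintype.card d : ℂ) ≠ 0 := by
    have : Nonempty d := ⟨i⟩
    exact_mod_cast Fintype.card_ne_zero
  have hD1 : (Fintype.card d : ℂ) + 1 ≠ 0 := by
    exact_mod_cast Nat.succ_ne_zero (Fintype.card d)
  have h1 : ∫ ρ, ρ i j ∂μ = ∑ k, ∫ ρ, ρ i j * ρ k k ∂μ := by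
    rw [← integral_finsetSum _ fun k _ => hμ.integrable_entry_mul i j k k]
    refine integral_congr_ae ?_
    filter_upwards [hμ.pure] with ρ hρ
    have := hρ.trace_eq_one
    simp only [Matrix.trace, Matrix.diag_apply] at this
    rw [← Finset.mul_sum, this, mul_one]
  rw [h1]
  simp_rw [hμ.integral_entry_mul]
  rw [← Finset.sum_div, Finset.sum_add_distrib]
  by_cases hij : i = j
  · subst hij
    have : ∀ k, (i = k ∧ k = i) ↔ k = i := fun k => ⟨fun h => h.2, fun h => ⟨h.symm, h⟩⟩
    simp [this]
    field_simp
  · have : ∀ k, ¬ (i = k ∧ k = j) := fun k h => hij (h.1.trans h.2)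
    simp [hij, this]

end Design

/-! ### The depolarizing channel as a mixture of Pauli strings -/

section Pauli

theorem prod_sum_sum {n : ℕ} {κ : Type*} [Fintype κ] (f : Fin n → κ → κ → ℂ) :
    ∏ m, ∑ a, ∑ b, f m a b =
      ∑ i : Fin n → κ, ∑ j : Fin n → κ, ∏ m, f m (i m) (j m) := by
  classical
  rw [Finset.prod_univ_sum, Fintype.piFinset_univ]
  refine Finset.sum_congr rfl fun k _ => ?_
  rw [Finset.prod_univ_sum, Fintype.piFinset_univ]

theorem prod_sum_fun {n : ℕ} {κ R : Type*} [Fintype κ] [CommSemiring R] (f : Fin n → κ → R) :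
    ∏ m, ∑ a, f m a = ∑ i : Fin n → κ, ∏ m, f m (i m) := by
  classical
  rw [Finset.prod_univ_sum, Fintype.piFinset_univ]

/-- The identity and the three Pauli matrices. -/
def pauli : Fin 4 → Matrix (Fin 2) (Fin 2) ℂ :=
  ![1, !![0, 1; 1, 0], !![0, -Complex.I; Complex.I, 0], !![1, 0; 0, -1]]

/-- The probabilities with which the depolarizing channel applies the Pauli matrices. They are also
the eigenvalues of its Choi state. -/
def pauliWeight (p : ℝ) : Fin 4 → ℝ :=
  ![1 - 3 / 4 * p, p / 4, p / 4, p / 4]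

theorem sum_pauliWeight (p : ℝ) : ∑ a, pauliWeight p a = 1 := by
  simp [pauliWeight, Fin.sum_univ_four]; ring

theorem pauliWeight_nonneg {p : ℝ} (hp : p ∈ Set.Icc (0 : ℝ) (4 / 3)) (a : Fin 4) :
    0 ≤ pauliWeight p a := by
  obtain ⟨h0, h1⟩ := hp
  fin_cases a <;> simp [pauliWeight] <;> linarith

theorem pauli_mul_conjTranspose (a : Fin 4) : pauli a * (pauli a).conjTranspose = 1 := by
  ext i j
  fin_cases a <;> fin_cases i <;> fin_cases j <;>
    simp [pauli, Matrix.mul_apply, Fin.sum_univ_two, Matrix.conjTranspose_apply]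

theorem depol_single (p : ℝ) (k l i j : Fin 2) :
    depol p (Matrix.single k l 1) i j =
      ∑ a, (pauliWeight p a : ℂ) * (pauli a i k * star (pauli a j l)) := by
  simp only [Fin.sum_univ_four]
  fin_cases k <;> fin_cases l <;> fin_cases i <;> fin_cases j <;>
    simp [depol, pauli, pauliWeight, Matrix.trace] <;> ring

/-- The tensor product of the Pauli matrices with labels `k`. -/
def pauliString {n : ℕ} (k : Fin n → Fin 4) : Matrix (Fin n → Fin 2) (Fin n → Fin 2) ℂ :=
  Matrix.of fun i j => ∏ m, pauli (k m) (i m) (j m)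

theorem pauliString_mul_conjTranspose {n : ℕ} (k : Fin n → Fin 4) :
    pauliString k * (pauliString k).conjTranspose = 1 := by
  ext i j
  have h : ∀ m, ∑ a, pauli (k m) (i m) a * star (pauli (k m) (j m) a) =
      (1 : Matrix (Fin 2) (Fin 2) ℂ) (i m) (j m) := by
    intro m
    rw [← pauli_mul_conjTranspose (k m), Matrix.mul_apply]; rfl
  simp only [Matrix.mul_apply, Matrix.conjTranspose_apply, pauliString, Matrix.of_apply, star_prod,
    ← Finset.prod_mul_distrib]
  rw [← prod_sum_fun (fun m a => pauli (k m) (i m) a * star (pauli (k m) (j m) a))]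
  simp only [h, Matrix.one_apply]
  by_cases hij : i = j
  · simp [hij]
  · obtain ⟨m, hm⟩ := Function.ne_iff.1 hij
    rw [if_neg hij]
    exact Finset.prod_eq_zero (Finset.mem_univ m) (if_neg hm)

theorem conjTranspose_pauliString_mul {n : ℕ} (k : Fin n → Fin 4) :
    (pauliString k).conjTranspose * pauliString k = 1 :=
  mul_eq_one_comm.1 (pauliString_mul_conjTranspose k)

/-- The probability of a Pauli string under the tensor power of the depolarizing channel. -/
def stringWeight (p : ℝ) {n : ℕ} (k : Fin n → Fin 4) : ℝ := ∏ m, pauliWeight p (k m)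

theorem stringWeight_nonneg {p : ℝ} (hp : p ∈ Set.Icc (0 : ℝ) (4 / 3)) {n : ℕ}
    (k : Fin n → Fin 4) : 0 ≤ stringWeight p k :=
  Finset.prod_nonneg fun _ _ => pauliWeight_nonneg hp _

theorem sum_stringWeight (p : ℝ) (n : ℕ) : ∑ k : Fin n → Fin 4, stringWeight p k = 1 := by
  unfold stringWeight
  rw [← prod_sum_fun (fun _ a => pauliWeight p a)]
  simp [sum_pauliWeight]

theorem tensorPower_depol (p : ℝ) (n : ℕ) (X : Matrix (Fin n → Fin 2) (Fin n → Fin 2) ℂ) :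
    tensorPower n (depol p) X = ∑ k : Fin n → Fin 4, (stringWeight p k : ℂ) •
      (pauliString k * X * (pauliString k).conjTranspose) := by
  ext i j
  simp only [tensorPower, LinearMap.coe_mk, AddHom.coe_mk, Matrix.of_apply, depol_single]
  simp_rw [prod_sum_fun]
  simp only [Matrix.sum_apply, Matrix.smul_apply, smul_eq_mul, Matrix.mul_apply,
    Matrix.conjTranspose_apply, pauliString, Matrix.of_apply, star_prod, stringWeight,
    Finset.prod_mul_distrib, Complex.ofReal_prod, Finset.mul_sum, Finset.sum_mul]
  rw [Finset.sum_comm]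
  simp_rw [fun l => Finset.sum_comm (s := (Finset.univ : Finset (Fin n → Fin 2)))
    (t := (Finset.univ : Finset (Fin n → Fin 4))) (f := l)]
  refine Finset.sum_congr rfl fun a _ => Finset.sum_congr rfl fun l _ =>
    Finset.sum_congr rfl fun k _ => ?_
  ring

theorem trace_tensorPower_depol (p : ℝ) (n : ℕ)
    (X : Matrix (Fin n → Fin 2) (Fin n → Fin 2) ℂ) :
    (tensorPower n (depol p) X).trace = X.trace := by
  rw [tensorPower_depol, Matrix.trace_sum]
  have : ∀ k : Fin n → Fin 4,
      (pauliString k * X * (pauliString k).conjTranspose).trace = X.trace := by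
    intro k
    rw [Matrix.trace_mul_comm, ← Matrix.mul_assoc, conjTranspose_pauliString_mul, one_mul]
  simp only [Matrix.trace_smul, this, ← Finset.sum_smul, ← Complex.ofReal_sum, sum_stringWeight]
  simp

theorem isHermitian_tensorPower_depol (p : ℝ) (n : ℕ)
    {X : Matrix (Fin n → Fin 2) (Fin n → Fin 2) ℂ} (hX : X.IsHermitian) :
    (tensorPower n (depol p) X).IsHermitian := by
  rw [tensorPower_depol, Matrix.IsHermitian, Matrix.conjTranspose_sum]
  refine Finset.sum_congr rfl fun k _ => ?_
  rw [Matrix.conjTranspose_smul]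
  simp only [Matrix.conjTranspose_mul, Matrix.conjTranspose_conjTranspose, hX.eq,
    Matrix.mul_assoc, RCLike.star_def, Complex.conj_ofReal]

theorem tensorPower_depol_one (p : ℝ) (n : ℕ) : tensorPower n (depol p) 1 = 1 := by
  rw [tensorPower_depol]
  simp only [mul_one, pauliString_mul_conjTranspose, ← Finset.sum_smul, ← Complex.ofReal_sum,
    sum_stringWeight]
  simp

/-- The trace norm of a Hermitian matrix does not increase under the channel. -/
theorem traceNorm_tensorPower_depol_le {p : ℝ} (hp : p ∈ Set.Icc (0 : ℝ) (4 / 3)) {n : ℕ}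
    {X : Matrix (Fin n → Fin 2) (Fin n → Fin 2) ℂ} (hX : X.IsHermitian) :
    traceNorm (tensorPower n (depol p) X) ≤ traceNorm X := by
  obtain ⟨W, hW, -, h⟩ :=
    exists_unitary_trace_mul_eq_traceNorm (isHermitian_tensorPower_depol p n hX)
  rw [← h, tensorPower_depol, Finset.mul_sum, Matrix.trace_sum, Complex.re_sum]
  calc ∑ k : Fin n → Fin 4, (W * (stringWeight p k : ℂ) •
        (pauliString k * X * (pauliString k).conjTranspose)).trace.re
      ≤ ∑ k : Fin n → Fin 4, stringWeight p k * traceNorm X := by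
        refine Finset.sum_le_sum fun k _ => ?_
        rw [mul_smul_comm, Matrix.trace_smul, smul_eq_mul, Complex.re_ofReal_mul]
        refine mul_le_mul_of_nonneg_left ?_ (stringWeight_nonneg hp k)
        have h1 : (W * (pauliString k * X * (pauliString k).conjTranspose)).trace =
            ((pauliString k).conjTranspose * W * pauliString k * X).trace := by
          rw [← Matrix.mul_assoc, Matrix.trace_mul_comm]
          simp only [Matrix.mul_assoc]
        rw [h1]
        refine re_trace_mul_le_traceNorm ?_ X
        calc _ = (pauliString k).conjTranspose * (W * (pauliString k *
              (pauliString k).conjTranspose) * W.conjTranspose) * pauliString k := by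
              simp only [Matrix.conjTranspose_mul, Matrix.conjTranspose_conjTranspose,
                Matrix.mul_assoc]
          _ = 1 := by
              rw [pauliString_mul_conjTranspose, mul_one, hW, mul_one,
                conjTranspose_pauliString_mul]
    _ = traceNorm X := by rw [← Finset.sum_mul, sum_stringWeight, one_mul]

end Pauli

/-! ### The Hilbert-Schmidt norm of the output -/

section SecondMoment

/-- The Hilbert-Schmidt inner product of the images of two matrix units under the channel. -/
def depolGram (p : ℝ) (k l k' l' : Fin 2) : ℂ :=
  ∑ i, ∑ j, depol p (Matrix.single k l 1) i j * depol p (Matrix.single k' l' 1) j i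

theorem sum_sum_mul_sum_sum {κ : Type*} [Fintype κ] (X Y : κ → κ → ℂ)
    (A B : κ → κ → κ → κ → ℂ) :
    ∑ i, ∑ j, (∑ k, ∑ l, X k l * A i j k l) * (∑ k, ∑ l, Y k l * B j i k l) =
      ∑ k, ∑ l, ∑ k', ∑ l', X k l * Y k' l' * ∑ i, ∑ j, A i j k l * B j i k' l' := by
  have h : ∀ (x y : κ × κ → ℂ) (a b : κ × κ → κ × κ → ℂ),
      ∑ t, (∑ u, x u * a t u) * (∑ v, y v * b t v) =
        ∑ u, ∑ v, x u * y v * ∑ t, a t u * b t v := by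
    intro x y a b
    simp_rw [Finset.sum_mul_sum, Finset.mul_sum]
    rw [Finset.sum_comm]
    refine Finset.sum_congr rfl fun u _ => ?_
    rw [Finset.sum_comm]
    refine Finset.sum_congr rfl fun v _ => Finset.sum_congr rfl fun t _ => ?_
    ring
  have := h (fun u => X u.1 u.2) (fun u => Y u.1 u.2) (fun t u => A t.1 t.2 u.1 u.2)
    (fun t u => B t.2 t.1 u.1 u.2)
  simpa only [Fintype.sum_prod_type] using this

/-- The kernel of the quadratic form `Tr (T X)²` factorizes over the qubits. -/
theorem trace_tensorPower_mul_self (p : ℝ) (n : ℕ)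
    (X : Matrix (Fin n → Fin 2) (Fin n → Fin 2) ℂ) :
    (tensorPower n (depol p) X * tensorPower n (depol p) X).trace =
      ∑ k, ∑ l, ∑ k', ∑ l', X k l * X k' l' * ∏ m, depolGram p (k m) (l m) (k' m) (l' m) := by
  unfold depolGram
  simp_rw [prod_sum_sum]
  simp only [Matrix.trace, Matrix.diag_apply, Matrix.mul_apply, tensorPower, LinearMap.coe_mk,
    AddHom.coe_mk, Matrix.of_apply, Finset.prod_mul_distrib]
  exact sum_sum_mul_sum_sum X X _ _

theorem sum_depolGram_id (p : ℝ) : ∑ k, ∑ k', depolGram p k k k' k' = 2 := by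
  simp only [depolGram, Fin.sum_univ_two]
  simp [depol, Matrix.trace]
  ring

theorem sum_depolGram_flip (p : ℝ) :
    ∑ k, ∑ l, depolGram p k l l k = ((1 + 3 * (1 - p) ^ 2 : ℝ) : ℂ) := by
  simp only [depolGram, Fin.sum_univ_two]
  simp [depol, Matrix.trace]
  ring

end SecondMoment

/-! ### Moments of differences of independent states -/

section DesignMoment

variable {d : Type*} [Fintype d] [DecidableEq d] {μ : Measure (Matrix d d ℂ)}

theorem IsStateDesign.integrable_sub_mul_sub (hμ : IsStateDesign 2 μ) (i j k l : d) :
    Integrable (fun x : Matrix d d ℂ × Matrix d d ℂ => (x.1 - x.2) i j * (x.1 - x.2) k l)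
      (μ.prod μ) := by
  have := hμ.prob
  have h : (fun x : Matrix d d ℂ × Matrix d d ℂ => (x.1 - x.2) i j * (x.1 - x.2) k l) =
      fun x => x.1 i j * x.1 k l - x.1 i j * x.2 k l - x.1 k l * x.2 i j + x.2 i j * x.2 k l := by
    ext x; simp only [Matrix.sub_apply]; ring
  rw [h]
  exact ((((hμ.integrable_entry_mul i j k l).comp_fst μ).sub
    ((hμ.integrable_entry i j).mul_prod (hμ.integrable_entry k l))).sub
    ((hμ.integrable_entry k l).mul_prod (hμ.integrable_entry i j))).add
    ((hμ.integrable_entry_mul i j k l).comp_snd μ)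

theorem IsStateDesign.integral_sub_mul_sub (hμ : IsStateDesign 2 μ) (i j k l : d) :
    ∫ x : Matrix d d ℂ × Matrix d d ℂ, (x.1 - x.2) i j * (x.1 - x.2) k l ∂(μ.prod μ) =
      2 * (((if i = j ∧ k = l then 1 else 0) + (if i = l ∧ k = j then 1 else 0)) /
        (Fintype.card d * (Fintype.card d + 1))) -
        2 * ((if i = j ∧ k = l then 1 else 0) / (Fintype.card d) ^ 2) := by
  have := hμ.prob
  have h : (fun x : Matrix d d ℂ × Matrix d d ℂ => (x.1 - x.2) i j * (x.1 - x.2) k l) =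
      (fun x => x.1 i j * x.1 k l) - (fun x => x.1 i j * x.2 k l) -
        (fun x => x.1 k l * x.2 i j) + fun x => x.2 i j * x.2 k l := by
    ext x; simp only [Matrix.sub_apply, Pi.sub_apply, Pi.add_apply]; ring
  have i1 := (hμ.integrable_entry_mul i j k l).comp_fst μ
  have i2 := (hμ.integrable_entry i j).mul_prod (hμ.integrable_entry k l)
  have i3 := (hμ.integrable_entry k l).mul_prod (hμ.integrable_entry i j)
  have i4 := (hμ.integrable_entry_mul i j k l).comp_snd μ
  rw [h, integral_add' ((i1.sub i2).sub i3) i4, integral_sub' (i1.sub i2) i3, integral_sub' i1 i2,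
    integral_prod_mul (fun ρ : Matrix d d ℂ => ρ i j) (fun ρ : Matrix d d ℂ => ρ k l),
    integral_prod_mul (fun ρ : Matrix d d ℂ => ρ k l) (fun ρ : Matrix d d ℂ => ρ i j),
    integral_fun_fst (fun ρ : Matrix d d ℂ => ρ i j * ρ k l),
    integral_fun_snd (fun ρ : Matrix d d ℂ => ρ i j * ρ k l)]
  simp only [probReal_univ, one_smul, hμ.integral_entry, hμ.integral_entry_mul]
  by_cases hij : i = j <;> by_cases hkl : k = l <;> simp [hij, hkl] <;> ring

/-- For independent states `ρ`, `σ` the overlap `Tr (ρ σ)` has expectation `1 / D`. -/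
theorem IsStateDesign.integral_trace_mul [Nonempty d] (hμ : IsStateDesign 2 μ) :
    Integrable (fun x : Matrix d d ℂ × Matrix d d ℂ => (x.1 * x.2).trace) (μ.prod μ) ∧
    ∫ x : Matrix d d ℂ × Matrix d d ℂ, (x.1 * x.2).trace ∂(μ.prod μ) =
      (Fintype.card d : ℂ)⁻¹ := by
  have := hμ.prob
  have hi : ∀ i j : d, Integrable
      (fun x : Matrix d d ℂ × Matrix d d ℂ => x.1 i j * x.2 j i) (μ.prod μ) :=
    fun i j => (hμ.integrable_entry i j).mul_prod (hμ.integrable_entry j i)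
  simp only [Matrix.trace, Matrix.diag_apply, Matrix.mul_apply]
  refine ⟨integrable_finsetSum _ fun i _ => integrable_finsetSum _ fun j _ => hi i j, ?_⟩
  rw [integral_finsetSum _ fun i _ => integrable_finsetSum _ fun j _ => hi i j]
  simp_rw [integral_finsetSum _ fun j _ => hi _ j]
  have h : ∀ i j : d, ∫ x : Matrix d d ℂ × Matrix d d ℂ, x.1 i j * x.2 j i ∂(μ.prod μ) =
      if i = j then (Fintype.card d : ℂ)⁻¹ * (Fintype.card d : ℂ)⁻¹ else 0 := by
    intro i j
    rw [integral_prod_mul (fun ρ : Matrix d d ℂ => ρ i j) (fun ρ : Matrix d d ℂ => ρ j i)]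
    simp only [hμ.integral_entry]
    by_cases hij : i = j
    · simp [hij]
    · simp [hij]
  have hD : (Fintype.card d : ℂ) ≠ 0 := by exact_mod_cast Fintype.card_ne_zero
  simp [h]

end DesignMoment

section OutputMoment

variable {n : ℕ} {μ : Measure (Matrix (Fin n → Fin 2) (Fin n → Fin 2) ℂ)}

theorem IsStateDesign.integrable_trace_tensorPower_sq (hμ : IsStateDesign 2 μ) (p : ℝ) :
    Integrable (fun x : Matrix (Fin n → Fin 2) (Fin n → Fin 2) ℂ ×
      Matrix (Fin n → Fin 2) (Fin n → Fin 2) ℂ =>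
      (tensorPower n (depol p) (x.1 - x.2) * tensorPower n (depol p) (x.1 - x.2)).trace)
      (μ.prod μ) := by
  simp only [trace_tensorPower_mul_self]
  exact integrable_finsetSum _ fun k _ => integrable_finsetSum _ fun l _ =>
    integrable_finsetSum _ fun k' _ => integrable_finsetSum _ fun l' _ =>
      (hμ.integrable_sub_mul_sub k l k' l').mul_const _

/-- The terms `2 ^ n` and `(1 + 3 (1 - p) ^ 2) ^ n` are the pairings of the factorized kernel with the
identity and with the flip. -/
theorem IsStateDesign.integral_trace_tensorPower_sq (hμ : IsStateDesign 2 μ) (p : ℝ) :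
    ∫ x : Matrix (Fin n → Fin 2) (Fin n → Fin 2) ℂ × Matrix (Fin n → Fin 2) (Fin n → Fin 2) ℂ,
      (tensorPower n (depol p) (x.1 - x.2) * tensorPower n (depol p) (x.1 - x.2)).trace
        ∂(μ.prod μ) =
      ((2 * ((2 ^ n + (1 + 3 * (1 - p) ^ 2) ^ n) / (2 ^ n * (2 ^ n + 1))) - 2 / 2 ^ n : ℝ) : ℂ) := by
  simp only [trace_tensorPower_mul_self]
  have hi : ∀ k l k' l' : Fin n → Fin 2, Integrable
      (fun x : Matrix (Fin n → Fin 2) (Fin n → Fin 2) ℂ ×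
        Matrix (Fin n → Fin 2) (Fin n → Fin 2) ℂ => (x.1 - x.2) k l * (x.1 - x.2) k' l' *
          ∏ m, depolGram p (k m) (l m) (k' m) (l' m)) (μ.prod μ) :=
    fun k l k' l' => (hμ.integrable_sub_mul_sub k l k' l').mul_const _
  rw [integral_finsetSum _ fun k _ => integrable_finsetSum _ fun l _ =>
    integrable_finsetSum _ fun k' _ => integrable_finsetSum _ fun l' _ => hi k l k' l']
  simp_rw [integral_finsetSum _ fun l _ =>
    integrable_finsetSum _ fun k' _ => integrable_finsetSum _ fun l' _ => hi _ l k' l',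
    integral_finsetSum _ fun k' _ => integrable_finsetSum _ fun l' _ => hi _ _ k' l',
    integral_finsetSum _ fun l' _ => hi _ _ _ l', integral_mul_const, hμ.integral_sub_mul_sub]
  have hid : ∑ k : Fin n → Fin 2, ∑ l : Fin n → Fin 2,
      ∑ k' : Fin n → Fin 2, ∑ l' : Fin n → Fin 2, (if k = l ∧ k' = l' then (1 : ℂ) else 0) *
      ∏ m, depolGram p (k m) (l m) (k' m) (l' m) = 2 ^ n := by
    simp only [ite_and, ite_mul, one_mul, zero_mul, Finset.sum_ite_eq, Finset.mem_univ, if_true,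
      Finset.sum_ite_irrel, Finset.sum_const_zero]
    rw [← prod_sum_sum (fun _ k k' => depolGram p k k k' k')]
    simp only [sum_depolGram_id, Finset.prod_const, Finset.card_univ, Fintype.card_fin]
  have hflip : ∑ k : Fin n → Fin 2, ∑ l : Fin n → Fin 2,
      ∑ k' : Fin n → Fin 2, ∑ l' : Fin n → Fin 2, (if k = l' ∧ k' = l then (1 : ℂ) else 0) *
      ∏ m, depolGram p (k m) (l m) (k' m) (l' m) =
        ((1 + 3 * (1 - p) ^ 2 : ℝ) : ℂ) ^ n := by
    simp only [ite_and, ite_mul, one_mul, zero_mul, Finset.sum_ite_eq, Finset.sum_ite_eq',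
      Finset.mem_univ, if_true]
    rw [← prod_sum_sum (fun _ k l => depolGram p k l l k)]
    simp only [sum_depolGram_flip, Finset.prod_const, Finset.card_univ, Fintype.card_fin]
  have hcard : (Fintype.card (Fin n → Fin 2) : ℂ) = 2 ^ n := by simp
  rw [hcard]
  set b : ℂ := 2 / (2 ^ n * (2 ^ n + 1)) with hb
  set c : ℂ := 2 / (2 ^ n) ^ 2 with hcdef
  have hsplit : ∀ k l k' l' : Fin n → Fin 2,
      (2 * (((if k = l ∧ k' = l' then (1 : ℂ) else 0) + (if k = l' ∧ k' = l then 1 else 0)) /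
        (2 ^ n * (2 ^ n + 1))) - 2 * ((if k = l ∧ k' = l' then 1 else 0) / (2 ^ n) ^ 2)) *
        ∏ m, depolGram p (k m) (l m) (k' m) (l' m) =
      (b - c) * ((if k = l ∧ k' = l' then (1 : ℂ) else 0) *
        ∏ m, depolGram p (k m) (l m) (k' m) (l' m)) +
      b * ((if k = l' ∧ k' = l then (1 : ℂ) else 0) *
        ∏ m, depolGram p (k m) (l m) (k' m) (l' m)) := by
    intro k l k' l'
    rw [hb, hcdef]; ring
  simp only [hsplit, Finset.sum_add_distrib, ← Finset.mul_sum, hid, hflip]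
  rw [hb, hcdef]
  have h2 : (2 : ℂ) ^ n ≠ 0 := pow_ne_zero n two_ne_zero
  have h3 : (2 : ℂ) ^ n + 1 ≠ 0 := by
    exact_mod_cast Nat.succ_ne_zero (2 ^ n)
  push_cast
  field_simp
  ring

theorem output_moment_le (n : ℕ) {g : ℝ} (hg : 0 ≤ g) :
    2 * ((2 ^ n + g ^ n) / (2 ^ n * (2 ^ n + 1))) - 2 / 2 ^ n ≤ 2 * (g / 2) ^ n / 2 ^ n := by
  have h2 : (0 : ℝ) < 2 ^ n := by positivity
  rw [div_pow, sub_le_iff_le_add]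
  have hgn : 0 ≤ g ^ n := pow_nonneg hg n
  have e : 2 * (g ^ n / 2 ^ n) / 2 ^ n + 2 / 2 ^ n -
      2 * ((2 ^ n + g ^ n) / (2 ^ n * (2 ^ n + 1))) =
      2 * (2 ^ n + g ^ n) / (2 ^ n * 2 ^ n * (2 ^ n + 1)) := by
    field_simp; ring
  have : 0 ≤ 2 * (2 ^ n + g ^ n) / (2 ^ n * 2 ^ n * (2 ^ n + 1)) := by positivity
  linarith

end OutputMoment

/-! ### The entropy of the Choi state and the threshold `p₁` -/

section Entropy

theorem choi_depol (p : ℝ) : choi (depol p) =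
    ((p / 4 : ℝ) : ℂ) • (1 : Matrix (Fin 2 × Fin 2) (Fin 2 × Fin 2) ℂ) +
      (((1 - p) / 2 : ℝ) : ℂ) • Matrix.of fun i j => if i.1 = i.2 ∧ j.1 = j.2 then 1 else 0 := by
  ext ⟨i, i'⟩ ⟨j, j'⟩
  simp only [choi, Fin.sum_univ_two]
  fin_cases i <;> fin_cases j <;> fin_cases i' <;> fin_cases j' <;>
    simp [depol, Matrix.trace] <;> ring

/-- Sums over a family with only two values, whose multiplicities are determined by its sum. This
yields functions of the spectrum of the Choi state from its minimal polynomial and its trace. -/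
theorem sum_of_two_values {ι : Type*} [Fintype ι] (x : ι → ℝ) {a b : ℝ} {N : ℕ}
    (hx : ∀ i, x i = a ∨ x i = b) (hc : Fintype.card ι = N + 1) (hs : ∑ i, x i = a + N * b)
    (f : ℝ → ℝ) : ∑ i, f (x i) = f a + N * f b := by
  by_cases hab : a = b
  · subst hab
    have : ∀ i, x i = a := fun i => (hx i).elim id id
    simp only [this, Finset.sum_const, Finset.card_univ, hc, nsmul_eq_mul]
    push_cast; ring
  · have hab' : a - b ≠ 0 := sub_ne_zero.2 hab
    -- On the two values, `f` agrees with an affine function.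
    have : ∀ i, f (x i) = (f a - f b) / (a - b) * x i + (f b - (f a - f b) / (a - b) * b) := by
      intro i
      rcases hx i with h | h <;> rw [h]
      · field_simp; ring
      · ring
    simp only [this, Finset.sum_add_distrib, ← Finset.mul_sum, hs, Finset.sum_const,
      Finset.card_univ, hc, nsmul_eq_mul]
    push_cast; field_simp; ring

/-- The entropy, in nats, of the Choi state of the depolarizing channel. -/
def choiEntropy (p : ℝ) : ℝ := Real.negMulLog (1 - 3 / 4 * p) + 3 * Real.negMulLog (p / 4)

theorem entropy_choi_depol (p : ℝ) :
    entropy (choi (depol p)) =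
      -((1 - 3 / 4 * p) * Real.logb 2 (1 - 3 / 4 * p) + 3 * p / 4 * Real.logb 2 (p / 4)) := by
  set Q : Matrix (Fin 2 × Fin 2) (Fin 2 × Fin 2) ℂ :=
    Matrix.of fun i j => if i.1 = i.2 ∧ j.1 = j.2 then 1 else 0 with hQ
  have hQh : Q.conjTranspose = Q := by
    ext ⟨i, i'⟩ ⟨j, j'⟩
    fin_cases i <;> fin_cases j <;> fin_cases i' <;> fin_cases j' <;> simp [hQ]
  have hQQ : Q * Q = (2 : ℂ) • Q := by
    ext ⟨i, i'⟩ ⟨j, j'⟩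
    simp only [hQ, Matrix.mul_apply, Fintype.sum_prod_type, Fin.sum_univ_two]
    fin_cases i <;> fin_cases j <;> fin_cases i' <;> fin_cases j' <;> simp <;> norm_num
  have hQt : Q.trace = 2 := by
    simp only [hQ, Matrix.trace, Fintype.sum_prod_type, Fin.sum_univ_two]
    simp; norm_num
  have hC := choi_depol p
  rw [← hQ] at hC
  set C := choi (depol p) with hCdef
  have hH : C.IsHermitian := by
    rw [Matrix.IsHermitian, hC, Matrix.conjTranspose_add, Matrix.conjTranspose_smul,
      Matrix.conjTranspose_smul, hQh, Matrix.conjTranspose_one]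
    simp only [RCLike.star_def, Complex.conj_ofReal]
  -- The Choi matrix is annihilated by the quadratic polynomial with roots `1 - 3 p / 4`, `p / 4`.
  have hCC : C * C = ((1 - p / 2 : ℝ) : ℂ) • C +
      ((-((1 - 3 / 4 * p) * (p / 4)) : ℝ) : ℂ) • (1 : Matrix _ _ ℂ) := by
    rw [hC]
    simp only [add_mul, mul_add, smul_mul_assoc, mul_smul_comm, one_mul, mul_one, hQQ]
    push_cast
    module
  obtain ⟨V, hV, hV', h⟩ := exists_diagonalization hH
  have hval : ∀ i, hH.eigenvalues i = 1 - 3 / 4 * p ∨ hH.eigenvalues i = p / 4 := by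
    intro i
    have hL : Matrix.diagonal (fun i => (hH.eigenvalues i : ℂ)) = V.conjTranspose * C * V := by
      conv_rhs => rw [h]
      calc _ = (V.conjTranspose * V) * Matrix.diagonal (fun i => (hH.eigenvalues i : ℂ)) *
            (V.conjTranspose * V) := by rw [hV', one_mul, mul_one]
        _ = _ := by simp only [Matrix.mul_assoc]
    have hLL : Matrix.diagonal (fun i => (hH.eigenvalues i : ℂ)) *
        Matrix.diagonal (fun i => (hH.eigenvalues i : ℂ)) =
        ((1 - p / 2 : ℝ) : ℂ) • Matrix.diagonal (fun i => (hH.eigenvalues i : ℂ)) +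
          ((-((1 - 3 / 4 * p) * (p / 4)) : ℝ) : ℂ) • (1 : Matrix _ _ ℂ) := by
      calc _ = V.conjTranspose * C * (V * V.conjTranspose) * C * V := by
            rw [hL]; simp only [Matrix.mul_assoc]
        _ = V.conjTranspose * (C * C) * V := by rw [hV, mul_one]; simp only [Matrix.mul_assoc]
        _ = _ := by
            rw [hCC, hL]
            simp only [mul_add, add_mul, smul_mul_assoc, mul_smul_comm, mul_one, hV']
    have hi := congrFun (congrFun hLL i) i
    simp only [Matrix.diagonal_mul_diagonal, Matrix.diagonal_apply_eq, Matrix.add_apply,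
      Matrix.smul_apply, Matrix.one_apply_eq, smul_eq_mul] at hi
    have hr : hH.eigenvalues i * hH.eigenvalues i = (1 - p / 2) * hH.eigenvalues i +
        -((1 - 3 / 4 * p) * (p / 4)) * 1 := by exact_mod_cast hi
    have : (hH.eigenvalues i - (1 - 3 / 4 * p)) * (hH.eigenvalues i - p / 4) = 0 := by
      linear_combination hr
    rcases mul_eq_zero.1 this with h | h
    · left; linarith
    · right; linarith
  have htr : ∑ i, hH.eigenvalues i = (1 - 3 / 4 * p) + (3 : ℕ) * (p / 4) := by
    have h1 : C.trace = 1 := by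
      rw [hC, Matrix.trace_add, Matrix.trace_smul, Matrix.trace_smul, hQt, Matrix.trace_one]
      simp
    have h2 := hH.trace_eq_sum_eigenvalues
    rw [h1] at h2
    have h3 : (1 : ℝ) = ∑ i, hH.eigenvalues i := by
      have := congrArg Complex.re h2
      simpa using this
    rw [← h3]; push_cast; ring
  have := sum_of_two_values hH.eigenvalues hval (N := 3) (by simp) htr
    (fun x => x * Real.logb 2 x)
  rw [entropy, dif_pos hH, this]
  push_cast; ring

theorem choiEntropy_eq (p : ℝ) :
    (1 - 3 / 4 * p) * Real.logb 2 (1 - 3 / 4 * p) + 3 * p / 4 * Real.logb 2 (p / 4) =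
      -(choiEntropy p / Real.log 2) := by
  simp only [choiEntropy, Real.negMulLog, Real.logb]; ring

theorem strictConcaveOn_choiEntropy : StrictConcaveOn ℝ (Set.Icc 0 (4 / 3)) choiEntropy := by
  refine ⟨convex_Icc _ _, ?_⟩
  intro x hx y hy hxy a b ha hb hab
  have h1 := Real.strictConcaveOn_negMulLog.2 (x := 1 - 3 / 4 * x) (y := 1 - 3 / 4 * y)
    (Set.mem_Ici.2 (by linarith [hx.2])) (Set.mem_Ici.2 (by linarith [hy.2]))
    (fun h => hxy (by linarith)) ha hb hab
  have h2 := Real.strictConcaveOn_negMulLog.2 (x := x / 4) (y := y / 4)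
    (Set.mem_Ici.2 (by linarith [hx.1])) (Set.mem_Ici.2 (by linarith [hy.1]))
    (fun h => hxy (by linarith)) ha hb hab
  simp only [smul_eq_mul] at h1 h2 ⊢
  have e1 : a * (1 - 3 / 4 * x) + b * (1 - 3 / 4 * y) = 1 - 3 / 4 * (a * x + b * y) := by
    linear_combination hab
  have e2 : a * (x / 4) + b * (y / 4) = (a * x + b * y) / 4 := by ring
  rw [e1] at h1
  rw [e2] at h2
  simp only [choiEntropy]
  linarith

theorem continuous_choiEntropy : Continuous choiEntropy := by
  unfold choiEntropy
  exact (Real.continuous_negMulLog.comp (by fun_prop)).add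
    (continuous_const.mul (Real.continuous_negMulLog.comp (by fun_prop)))

/-- The bound is equivalent to `2 ^ 48 < 13 ^ 13`. -/
theorem choiEntropy_lt : choiEntropy (1 / 4) < Real.log 2 := by
  have h : 48 * Real.log 2 < 13 * Real.log 13 := by
    have := Real.log_lt_log (by norm_num) (show (2 : ℝ) ^ 48 < 13 ^ 13 by norm_num)
    rw [Real.log_pow, Real.log_pow] at this
    exact_mod_cast this
  have e1 : Real.log (1 - 3 / 4 * (1 / 4)) = Real.log 13 - 4 * Real.log 2 := by
    rw [show (1 - 3 / 4 * (1 / 4) : ℝ) = 13 / 2 ^ 4 by norm_num,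
      Real.log_div (by norm_num) (by norm_num), Real.log_pow]
    norm_num
  have e2 : Real.log (1 / 4 / 4) = -4 * Real.log 2 := by
    rw [show (1 / 4 / 4 : ℝ) = 1 / 2 ^ 4 by norm_num,
      Real.log_div (by norm_num) (by norm_num), Real.log_pow]
    norm_num
  simp only [choiEntropy, Real.negMulLog, e1, e2]
  linarith

/-- The bound is equivalent to `2 ^ 87 * 51 ^ 51 < 63 ^ 63`. -/
theorem lt_choiEntropy : Real.log 2 < choiEntropy (16 / 63) := by
  have h : 87 * Real.log 2 + 51 * Real.log 51 < 63 * Real.log 63 := by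
    have := Real.log_lt_log (by norm_num)
      (show (2 : ℝ) ^ 87 * 51 ^ 51 < 63 ^ 63 by norm_num)
    rw [Real.log_mul (by norm_num) (by norm_num), Real.log_pow, Real.log_pow, Real.log_pow] at this
    exact_mod_cast this
  have e1 : Real.log (1 - 3 / 4 * (16 / 63)) = Real.log 51 - Real.log 63 := by
    rw [show (1 - 3 / 4 * (16 / 63) : ℝ) = 51 / 63 by norm_num,
      Real.log_div (by norm_num) (by norm_num)]
  have e2 : Real.log (16 / 63 / 4) = 2 * Real.log 2 - Real.log 63 := by
    rw [show (16 / 63 / 4 : ℝ) = 2 ^ 2 / 63 by norm_num,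
      Real.log_div (by norm_num) (by norm_num), Real.log_pow]
    norm_num
  simp only [choiEntropy, Real.negMulLog, e1, e2]
  linarith

theorem lt_choiEntropy_right : Real.log 2 < choiEntropy (4 / 3) := by
  have h : Real.log 2 < Real.log 3 := Real.log_lt_log (by norm_num) (by norm_num)
  have e1 : Real.log (4 / 3 / 4) = -Real.log 3 := by
    rw [show (4 / 3 / 4 : ℝ) = 3⁻¹ by norm_num, Real.log_inv]
  have e2 : (1 - 3 / 4 * (4 / 3) : ℝ) = 0 := by norm_num
  simp only [choiEntropy, Real.negMulLog, e1, e2]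
  linarith

/-- By strict concavity the entropy of the Choi state crosses one bit exactly once, from below. -/
theorem exists_threshold : ∃ p₁ : ℝ, |p₁ - 0.25| < 0.005 ∧
    (∀ p ∈ Set.Icc (0 : ℝ) (4 / 3), choiEntropy p = Real.log 2 ↔ p = p₁) ∧
    ∀ p ∈ Set.Icc (0 : ℝ) (4 / 3), p < p₁ → choiEntropy p < Real.log 2 := by
  obtain ⟨p₁, ⟨h0, h1⟩, h⟩ := intermediate_value_Icc (by norm_num : (1 / 4 : ℝ) ≤ 16 / 63)
    continuous_choiEntropy.continuousOn ⟨choiEntropy_lt.le, lt_choiEntropy.le⟩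
  have hp₁ : p₁ ∈ Set.Icc (0 : ℝ) (4 / 3) := ⟨by linarith, by linarith⟩
  have hright : (4 / 3 : ℝ) ∈ Set.Icc (0 : ℝ) (4 / 3) := ⟨by norm_num, le_rfl⟩
  have hR := lt_choiEntropy_right
  have hmin : ∀ x ∈ Set.Icc (0 : ℝ) (4 / 3), ∀ z, x < z → z < 4 / 3 →
      Real.log 2 ≤ choiEntropy x → Real.log 2 < choiEntropy z := by
    intro x hx z hxz hz hxl
    have := strictConcaveOn_choiEntropy.lt_on_openSegment hx hright (hxz.trans hz).ne
      (show z ∈ openSegment ℝ x (4 / 3) by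
        rw [openSegment_eq_Ioo (hxz.trans hz)]; exact ⟨hxz, hz⟩)
    exact (le_min hxl hR.le).trans_lt this
  have hlt : ∀ p ∈ Set.Icc (0 : ℝ) (4 / 3), p < p₁ → choiEntropy p < Real.log 2 := by
    intro p hp hpp
    by_contra! hge
    exact absurd h (hmin p hp p₁ hpp (by linarith) hge).ne'
  refine ⟨p₁, ?_, ?_, hlt⟩
  · rw [abs_lt]; constructor <;> norm_num at * <;> linarith
  · intro p hp
    refine ⟨fun hpe => ?_, fun hpe => hpe ▸ h⟩
    rcases lt_trichotomy p p₁ with hl | he | hg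
    · exact absurd hpe (hlt p hp hl).ne
    · exact he
    · rcases hp.2.lt_or_eq with hlt' | heq
      · exact absurd hpe (hmin p₁ hp₁ p hg hlt' h.ge).ne'
      · rw [heq] at hpe; exact absurd hpe hR.ne'

theorem abs_one_sub_one_div_sqrt_three_sub :
    |(1 - 1 / Real.sqrt 3) - 0.42| < 0.005 := by
  have h3 : 0 < Real.sqrt 3 := Real.sqrt_pos.2 (by norm_num)
  have hl : (1.73 : ℝ) < Real.sqrt 3 := by
    rw [Real.lt_sqrt (by norm_num)]; norm_num
  have hu : Real.sqrt 3 < (1.733 : ℝ) := by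
    rw [Real.sqrt_lt' (by norm_num)]; norm_num
  have e : 1 / Real.sqrt 3 = Real.sqrt 3 / 3 := by
    rw [div_eq_div_iff h3.ne' (by norm_num), Real.mul_self_sqrt (by norm_num)]; norm_num
  rw [e, abs_lt]
  constructor <;> norm_num at * <;> linarith

/-! ### Typical Pauli strings -/

/-- If the Choi state has entropy less than one bit, then exponentially fewer than `2 ^ n` Pauli
strings carry all but an exponentially small part of the probability. The strings are those of
probability at least `exp (-n r)`, for some `r` between the entropy and `log 2`; the probability of
the others is bounded by Chernoff's method. -/
theorem exists_typical {p : ℝ} (hp : p ∈ Set.Icc (0 : ℝ) (4 / 3))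
    (hS : choiEntropy p < Real.log 2) :
    ∃ a b : ℝ, 0 ≤ a ∧ a < 1 ∧ 0 ≤ b ∧ b < 1 ∧ ∀ n : ℕ, ∃ A : Finset (Fin n → Fin 4),
      (A.card : ℝ) ≤ (2 * a) ^ n ∧ 1 - b ^ n ≤ ∑ k ∈ A, stringWeight p k := by
  obtain ⟨r, hr1, hr2⟩ := exists_between hS
  set w := pauliWeight p with hw
  have hw0 : ∀ a, 0 ≤ w a := pauliWeight_nonneg hp
  -- The surprisal, centred at `r`; its value `-r` at a Pauli matrix of weight zero is never used,
  -- since it is always multiplied by the weight.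
  set Y : Fin 4 → ℝ := fun a => -Real.log (w a) - r with hY
  set g : ℝ → ℝ := fun s => ∑ a, w a * Real.exp (s * Y a) with hg
  have hg0 : g 0 = 1 := by simp [hg, hw, sum_pauliWeight]
  have hgd : HasDerivAt g (∑ a, w a * Y a) 0 := by
    have : HasDerivAt g (∑ a, w a * (Real.exp (0 * Y a) * (1 * Y a))) 0 := by
      apply HasDerivAt.fun_sum
      intro a _
      exact (((hasDerivAt_id (0 : ℝ)).mul_const (Y a)).exp).const_mul (w a)
    simpa using this
  have hneg : ∑ a, w a * Y a < 0 := by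
    have : ∑ a, w a * Y a = choiEntropy p - r := by
      have h1 : ∑ a, w a * Y a = ∑ a, Real.negMulLog (w a) - (∑ a, w a) * r := by
        rw [Finset.sum_mul, ← Finset.sum_sub_distrib]
        refine Finset.sum_congr rfl fun a _ => ?_
        simp only [hY, Real.negMulLog]; ring
      rw [h1, hw, sum_pauliWeight, one_mul]
      simp only [Fin.sum_univ_four, pauliWeight, choiEntropy]
      simp; ring
    rw [this]; linarith
  -- The generating function `g` has value one and negative slope at zero.
  obtain ⟨s, hs, hgs⟩ : ∃ s, 0 < s ∧ g s < 1 := by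
    have h1 := hgd.tendsto_slope_zero_right
    have h2 : ∀ᶠ t in 𝓝[>] (0 : ℝ), t⁻¹ • (g (0 + t) - g 0) < 0 := h1.eventually_lt_const hneg
    obtain ⟨t, ht, ht0⟩ := (h2.and self_mem_nhdsWithin).exists
    have ht0' : (0 : ℝ) < t := ht0
    refine ⟨t, ht0', ?_⟩
    rw [zero_add, hg0, smul_eq_mul] at ht
    have := (mul_neg_iff.1 ht).resolve_right (fun h => absurd h.1 (not_lt.2 (inv_nonneg.2 ht0'.le)))
    linarith [this.2]
  have hgs0 : 0 ≤ g s := Finset.sum_nonneg fun a _ => mul_nonneg (hw0 a) (Real.exp_nonneg _)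
  refine ⟨Real.exp r / 2, g s, by positivity, ?_, hgs0, hgs, fun n => ?_⟩
  · have := Real.exp_lt_exp.2 hr2
    rw [Real.exp_log (by norm_num)] at this
    linarith
  · have hpos : ∀ k : Fin n → Fin 4, 0 ≤ stringWeight p k := stringWeight_nonneg hp
    have hYsum : ∀ k : Fin n → Fin 4, 0 < stringWeight p k →
        ∑ m, Y (k m) = -Real.log (stringWeight p k) - n * r := by
      intro k hk
      have hne : ∀ m ∈ Finset.univ, pauliWeight p (k m) ≠ 0 :=
        Finset.prod_ne_zero_iff.1 hk.ne'
      simp only [hY, Finset.sum_sub_distrib, Finset.sum_neg_distrib, stringWeight]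
      rw [Real.log_prod hne]
      simp [hw]
    set A : Finset (Fin n → Fin 4) :=
      Finset.univ.filter fun k => Real.exp (-(n * r)) ≤ stringWeight p k with hA
    refine ⟨A, ?_, ?_⟩
    · have h1 : (A.card : ℝ) * Real.exp (-(n * r)) ≤ 1 := by
        rw [← nsmul_eq_mul, ← sum_stringWeight p n]
        refine (Finset.card_nsmul_le_sum A _ _ fun k hk => ?_).trans
          (Finset.sum_le_univ_sum_of_nonneg hpos)
        exact (Finset.mem_filter.1 hk).2
      rw [Real.exp_neg, ← div_eq_mul_inv, div_le_one (Real.exp_pos _), Real.exp_nat_mul] at h1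
      rwa [mul_div_cancel₀ _ (two_ne_zero)]
    · have hsplit : ∑ k ∈ A, stringWeight p k + ∑ k ∈ Aᶜ, stringWeight p k = 1 := by
        rw [Finset.sum_add_sum_compl, sum_stringWeight]
      have hcompl : ∑ k ∈ Aᶜ, stringWeight p k ≤ g s ^ n := by
        have hterm : ∀ k ∈ Aᶜ, stringWeight p k ≤
            stringWeight p k * Real.exp (s * ∑ m, Y (k m)) := by
          intro k hk
          rcases (hpos k).eq_or_lt with h0 | h0
          · rw [← h0, zero_mul]
          · refine le_mul_of_one_le_right h0.le (Real.one_le_exp (mul_nonneg hs.le ?_))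
            rw [hYsum k h0]
            have hk' : stringWeight p k < Real.exp (-(n * r)) := by
              simpa [hA] using hk
            have := Real.log_lt_log h0 hk'
            rw [Real.log_exp] at this
            linarith
        calc _ ≤ ∑ k ∈ Aᶜ, stringWeight p k * Real.exp (s * ∑ m, Y (k m)) :=
              Finset.sum_le_sum hterm
          _ ≤ ∑ k : Fin n → Fin 4, stringWeight p k * Real.exp (s * ∑ m, Y (k m)) :=
              Finset.sum_le_univ_sum_of_nonneg fun k =>
                mul_nonneg (hpos k) (Real.exp_nonneg _)
          _ = g s ^ n := by
              have : ∀ k : Fin n → Fin 4, stringWeight p k * Real.exp (s * ∑ m, Y (k m)) =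
                  ∏ m, (w (k m) * Real.exp (s * Y (k m))) := by
                intro k
                rw [Finset.mul_sum, Real.exp_sum, Finset.prod_mul_distrib]; rfl
              simp only [this]
              rw [← prod_sum_fun (fun _ a => w a * Real.exp (s * Y a))]
              simp [hg]
      linarith

end Entropy

/-! ### Pairs of pure states and the contraction ratio -/

section Pairs

variable {d : Type*} [Fintype d]

theorem norm_dotProduct_star_le_one {φ ψ : d → ℂ} (hφ : ∑ i, ‖φ i‖ ^ 2 = 1)
    (hψ : ∑ i, ‖ψ i‖ ^ 2 = 1) : ‖dotProduct φ (star ψ)‖ ≤ 1 := by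
  calc ‖dotProduct φ (star ψ)‖ ≤ ∑ i, ‖φ i‖ * ‖ψ i‖ := by
        refine (norm_sum_le _ _).trans (Finset.sum_le_sum fun i _ => ?_)
        rw [norm_mul, Pi.star_apply, norm_star]
    _ ≤ 1 := by
        have := Real.sum_mul_le_sqrt_mul_sqrt Finset.univ (fun i => ‖φ i‖) fun i => ‖ψ i‖
        rwa [hφ, hψ, Real.sqrt_one, one_mul] at this

theorem IsPureState.trace_mul_self {ρ : Matrix d d ℂ} (h : IsPureState ρ) :
    (ρ * ρ).trace = 1 := by
  have h1 : (ρ * ρ).trace = ρ.trace * ρ.trace := by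
    simp only [Matrix.trace, Matrix.diag_apply, Matrix.mul_apply, Finset.sum_mul_sum]
    refine Finset.sum_congr rfl fun i _ => Finset.sum_congr rfl fun j _ => ?_
    exact h.mul_comm_entries i j j i
  rw [h1, h.trace_eq_one, one_mul]

theorem IsPureState.re_trace_mul_nonneg {ρ σ : Matrix d d ℂ} (hρ : IsPureState ρ)
    (hσ : IsPureState σ) : 0 ≤ (ρ * σ).trace.re := by
  obtain ⟨ψ, -, rfl⟩ := hρ
  obtain ⟨φ, -, rfl⟩ := hσ
  have h : (Matrix.vecMulVec ψ (star ψ) * Matrix.vecMulVec φ (star φ)).trace =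
      ((‖dotProduct ψ (star φ)‖ ^ 2 : ℝ) : ℂ) := by
    rw [Complex.ofReal_pow, ← Complex.mul_conj', ← RCLike.star_def, ← Matrix.star_dotProduct_star,
      star_star]
    simp only [Matrix.trace, Matrix.diag_apply, Matrix.mul_apply, Matrix.vecMulVec_apply,
      dotProduct, Finset.sum_mul_sum]
    refine Finset.sum_congr rfl fun i _ => Finset.sum_congr rfl fun j _ => ?_
    simp only [Pi.star_apply]; ring
  rw [h, Complex.ofReal_re]
  positivity

/-- An orthogonal projection whose range contains given vectors, of rank at most their number. -/
theorem exists_projection {ι : Type*} (A : Finset ι) (v : ι → d → ℂ) :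
    ∃ Q : Matrix d d ℂ, Q.conjTranspose = Q ∧ Q * Q = Q ∧ Q.trace.re ≤ A.card ∧
      ∀ k ∈ A, Q.mulVec (v k) = v k := by
  classical
  set S : Submodule ℂ (EuclideanSpace ℂ d) :=
    Submodule.span ℂ ((A.image fun k => WithLp.toLp 2 (v k) : Finset _) : Set _) with hS
  set b := stdOrthonormalBasis ℂ S with hb
  set B : Matrix d (Fin (Module.finrank ℂ S)) ℂ :=
    Matrix.of fun i j => (b j : EuclideanSpace ℂ d) i with hB
  have hBB : B.conjTranspose * B = 1 := by
    ext i j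
    have h1 := orthonormal_iff_ite.1 b.orthonormal i j
    rw [Submodule.coe_inner, EuclideanSpace.inner_eq_star_dotProduct] at h1
    rw [Matrix.one_apply, ← h1]
    simp only [Matrix.mul_apply, Matrix.conjTranspose_apply, hB, Matrix.of_apply, dotProduct,
      Pi.star_apply]
    exact Finset.sum_congr rfl fun _ _ => mul_comm _ _
  refine ⟨B * B.conjTranspose, ?_, ?_, ?_, ?_⟩
  · rw [Matrix.conjTranspose_mul, Matrix.conjTranspose_conjTranspose]
  · calc _ = B * (B.conjTranspose * B) * B.conjTranspose := by simp only [Matrix.mul_assoc]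
      _ = _ := by rw [hBB, Matrix.mul_one]
  · rw [Matrix.trace_mul_comm, hBB, Matrix.trace_one, Fintype.card_fin, Complex.natCast_re]
    have h1 : Module.finrank ℂ S ≤ _ := finrank_span_finset_le_card
      (R := ℂ) (A.image fun k => WithLp.toLp 2 (v k))
    exact_mod_cast h1.trans Finset.card_image_le
  · intro k hk
    have hkS : WithLp.toLp 2 (v k) ∈ S :=
      Submodule.subset_span (Finset.mem_coe.2 (Finset.mem_image_of_mem _ hk))
    have h1 := congrArg (fun x : S => (x : EuclideanSpace ℂ d)) (b.sum_repr' ⟨_, hkS⟩)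
    ext i
    have h2 := congrArg (fun x : EuclideanSpace ℂ d => x i) h1
    simp only [Submodule.coe_sum, Submodule.coe_smul, WithLp.ofLp_sum, Finset.sum_apply,
      PiLp.smul_apply, smul_eq_mul, Submodule.coe_inner,
      EuclideanSpace.inner_eq_star_dotProduct] at h2
    rw [← Matrix.mulVec_mulVec]
    conv_rhs => rw [← h2]
    simp only [Matrix.mulVec, dotProduct, hB, Matrix.of_apply, Matrix.conjTranspose_apply,
      Pi.star_apply]
    refine Finset.sum_congr rfl fun j _ => ?_
    rw [mul_comm]
    congr 1
    exact Finset.sum_congr rfl fun _ _ => mul_comm _ _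

variable [DecidableEq d]

theorem sum_norm_sq_mulVec {W : Matrix d d ℂ} (hW : W.conjTranspose * W = 1) {ψ : d → ℂ}
    (hψ : ∑ i, ‖ψ i‖ ^ 2 = 1) : ∑ i, ‖(W.mulVec ψ) i‖ ^ 2 = 1 := by
  have h : ∀ φ : d → ℂ, ((∑ i, ‖φ i‖ ^ 2 : ℝ) : ℂ) = dotProduct (star φ) φ := by
    intro φ
    simp only [dotProduct, Pi.star_apply, RCLike.star_def, Complex.conj_mul']
    push_cast; rfl
  have h1 : ((∑ i, ‖(W.mulVec ψ) i‖ ^ 2 : ℝ) : ℂ) = 1 := by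
    rw [h, Matrix.star_mulVec, ← Matrix.dotProduct_mulVec, Matrix.mulVec_mulVec, hW,
      Matrix.one_mulVec, ← h, hψ, Complex.ofReal_one]
  exact_mod_cast h1

theorem IsPureState.norm_trace_mul_le_one {ρ : Matrix d d ℂ} (h : IsPureState ρ)
    {W : Matrix d d ℂ} (hW : W.conjTranspose * W = 1) : ‖(W * ρ).trace‖ ≤ 1 := by
  obtain ⟨ψ, hψ, rfl⟩ := h
  rw [Matrix.mul_vecMulVec, Matrix.trace_vecMulVec]
  exact norm_dotProduct_star_le_one (sum_norm_sq_mulVec hW hψ) hψ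

theorem traceDist_nonneg (ρ σ : Matrix d d ℂ) : 0 ≤ traceDist ρ σ :=
  mul_nonneg (by norm_num) (traceNorm_nonneg _)

theorem traceDist_self (ρ : Matrix d d ℂ) : traceDist ρ ρ = 0 := by
  have h : traceNorm (0 : Matrix d d ℂ) ≤ 0 := by
    simpa using traceNorm_le_sum_norm (Matrix.isHermitian_zero (n := d) (α := ℂ))
  rw [traceDist, sub_self, le_antisymm h (traceNorm_nonneg _), mul_zero]

theorem IsPureState.traceDist_le_one {ρ σ : Matrix d d ℂ} (hρ : IsPureState ρ)
    (hσ : IsPureState σ) : traceDist ρ σ ≤ 1 := by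
  obtain ⟨W, -, hW, h⟩ :=
    exists_unitary_trace_mul_eq_traceNorm (hρ.isHermitian.sub hσ.isHermitian)
  rw [mul_sub, Matrix.trace_sub, Complex.sub_re] at h
  have h1 := (Complex.abs_re_le_norm _).trans (hρ.norm_trace_mul_le_one hW)
  have h2 := (Complex.abs_re_le_norm _).trans (hσ.norm_trace_mul_le_one hW)
  rw [traceDist]
  linarith [(abs_le.1 h1).2, (abs_le.1 h2).1]

/-- Two pure states of small overlap are far apart. -/
theorem IsPureState.two_sub_le_traceNorm_sq {ρ σ : Matrix d d ℂ} (hρ : IsPureState ρ)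
    (hσ : IsPureState σ) : 2 - 2 * (ρ * σ).trace.re ≤ traceNorm (ρ - σ) ^ 2 := by
  refine le_trans (le_of_eq ?_) (re_trace_conjTranspose_mul_self_le (ρ - σ))
  rw [(hρ.isHermitian.sub hσ.isHermitian).eq, sub_mul, mul_sub, mul_sub]
  simp only [Matrix.trace_sub, hρ.trace_mul_self, hσ.trace_mul_self, Matrix.trace_mul_comm σ ρ,
    Complex.sub_re, Complex.one_re]
  ring

/-- Helstrom's bound: a projective measurement distinguishes two states no better than their trace
distance. -/
theorem re_trace_projection_mul_le {Q : Matrix d d ℂ} (h1 : Q.conjTranspose = Q) (h2 : Q * Q = Q)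
    {X : Matrix d d ℂ} (hX : X.trace = 0) : (Q * X).trace.re ≤ 1 / 2 * traceNorm X := by
  -- The reflection `2 Q - 1` is unitary.
  have hM : ((2 : ℂ) • Q - 1) * ((2 : ℂ) • Q - 1).conjTranspose = 1 := by
    rw [Matrix.conjTranspose_sub, Matrix.conjTranspose_smul, h1, Matrix.conjTranspose_one]
    simp only [sub_mul, mul_sub, smul_mul_assoc, mul_smul_comm, h2, one_mul, mul_one,
      RCLike.star_def, map_ofNat]
    module
  have := re_trace_mul_le_traceNorm hM X
  rw [sub_mul, one_mul, Matrix.trace_sub, hX, sub_zero, smul_mul_assoc, Matrix.trace_smul,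
    smul_eq_mul] at this
  have e : (2 * (Q * X).trace).re = 2 * (Q * X).trace.re := by simp
  linarith

end Pairs

section Ratio

variable {n : ℕ}

/-- The factor by which the trace distance of a pair of states contracts. -/
def contractionRatio (p : ℝ) (n : ℕ)
    (x : Matrix (Fin n → Fin 2) (Fin n → Fin 2) ℂ × Matrix (Fin n → Fin 2) (Fin n → Fin 2) ℂ) : ℝ :=
  traceDist (tensorPower n (depol p) x.1) (tensorPower n (depol p) x.2) / traceDist x.1 x.2

theorem contractionRatio_nonneg (p : ℝ)
    (x : Matrix (Fin n → Fin 2) (Fin n → Fin 2) ℂ ×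
      Matrix (Fin n → Fin 2) (Fin n → Fin 2) ℂ) : 0 ≤ contractionRatio p n x :=
  div_nonneg (traceDist_nonneg _ _) (traceDist_nonneg _ _)

theorem contractionRatio_self (p : ℝ) (ρ : Matrix (Fin n → Fin 2) (Fin n → Fin 2) ℂ) :
    contractionRatio p n (ρ, ρ) = 0 := by
  simp [contractionRatio, traceDist_self]

variable {p : ℝ} {ρ σ : Matrix (Fin n → Fin 2) (Fin n → Fin 2) ℂ}

theorem traceDist_tensorPower_le (hp : p ∈ Set.Icc (0 : ℝ) (4 / 3)) (hρ : IsPureState ρ)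
    (hσ : IsPureState σ) :
    traceDist (tensorPower n (depol p) ρ) (tensorPower n (depol p) σ) ≤ traceDist ρ σ := by
  rw [traceDist, traceDist, ← map_sub]
  exact mul_le_mul_of_nonneg_left
    (traceNorm_tensorPower_depol_le hp (hρ.isHermitian.sub hσ.isHermitian)) (by norm_num)

theorem contractionRatio_le_one (hp : p ∈ Set.Icc (0 : ℝ) (4 / 3)) (hρ : IsPureState ρ)
    (hσ : IsPureState σ) : contractionRatio p n (ρ, σ) ≤ 1 :=
  div_le_one_of_le₀ (traceDist_tensorPower_le hp hρ hσ) (traceDist_nonneg _ _)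

/-- Dividing by the distance of the inputs, which is at most one, only helps; a vanishing distance of
the inputs forces a vanishing distance of the outputs. -/
theorem traceDist_tensorPower_le_contractionRatio (hp : p ∈ Set.Icc (0 : ℝ) (4 / 3))
    (hρ : IsPureState ρ) (hσ : IsPureState σ) :
    traceDist (tensorPower n (depol p) ρ) (tensorPower n (depol p) σ) ≤
      contractionRatio p n (ρ, σ) := by
  rcases (traceDist_nonneg ρ σ).eq_or_lt with h0 | h0
  · exact ((traceDist_tensorPower_le hp hρ hσ).trans h0.ge).trans (contractionRatio_nonneg _ _)
  · exact le_div_self (traceDist_nonneg _ _) h0 (hρ.traceDist_le_one hσ)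

/-- For pairs of small overlap the ratio is bounded by the trace norm of the output, and hence by
its Hilbert-Schmidt norm; for the other pairs the overlap term alone exceeds the ratio. -/
theorem contractionRatio_le (hp : p ∈ Set.Icc (0 : ℝ) (4 / 3)) (hρ : IsPureState ρ)
    (hσ : IsPureState σ) {ε : ℝ} (hε : 0 < ε) :
    contractionRatio p n (ρ, σ) ≤ ε + 2 ^ n / (4 * ε) *
      (tensorPower n (depol p) (ρ - σ) * tensorPower n (depol p) (ρ - σ)).trace.re +
        2 * (ρ * σ).trace.re := by
  have hH := hρ.isHermitian.sub hσ.isHermitian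
  have hT := isHermitian_tensorPower_depol p n hH
  have ht := hρ.re_trace_mul_nonneg hσ
  have hb := traceNorm_le_add (tensorPower n (depol p) (ρ - σ)) hε
  rw [hT.eq] at hb
  simp only [Fintype.card_pi, Fintype.card_fin, Finset.prod_const, Finset.card_univ,
    Nat.cast_pow, Nat.cast_ofNat] at hb
  have hT0 := traceNorm_nonneg (tensorPower n (depol p) (ρ - σ))
  by_cases hlt : (ρ * σ).trace.re ≤ 1 / 2
  · have h1 : 1 ≤ traceNorm (ρ - σ) := by
      have h2 := hρ.two_sub_le_traceNorm_sq hσ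
      have h3 := traceNorm_nonneg (ρ - σ)
      nlinarith
    have h2 : contractionRatio p n (ρ, σ) ≤ traceNorm (tensorPower n (depol p) (ρ - σ)) := by
      simp only [contractionRatio, traceDist, ← map_sub]
      rw [mul_div_mul_left _ _ (by norm_num)]
      exact div_le_self hT0 h1
    linarith
  · have := contractionRatio_le_one hp hρ hσ
    linarith

/-- A projection onto the span of the vectors `Pₖ ψ`, for the Pauli strings `k` in `A`, detects the
output for the input `ψ` with at least the probability of `A`. -/
theorem exists_detecting_projection (hp : p ∈ Set.Icc (0 : ℝ) (4 / 3)) (hρ : IsPureState ρ)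
    (A : Finset (Fin n → Fin 4)) :
    ∃ Q : Matrix (Fin n → Fin 2) (Fin n → Fin 2) ℂ, Q.conjTranspose = Q ∧ Q * Q = Q ∧
      Q.trace.re ≤ A.card ∧
      ∑ k ∈ A, stringWeight p k ≤ (Q * tensorPower n (depol p) ρ).trace.re := by
  obtain ⟨ψ, hψ, rfl⟩ := hρ
  obtain ⟨Q, h1, h2, h3, h4⟩ := exists_projection A fun k => (pauliString k).mulVec ψ
  refine ⟨Q, h1, h2, h3, ?_⟩
  have hterm : ∀ k : Fin n → Fin 4, (Q * (pauliString k * Matrix.vecMulVec ψ (star ψ) *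
      (pauliString k).conjTranspose)).trace.re =
        ∑ i, ‖(Q.mulVec ((pauliString k).mulVec ψ)) i‖ ^ 2 := by
    intro k
    rw [Matrix.mul_vecMulVec, Matrix.vecMulVec_mul, ← Matrix.star_mulVec, Matrix.mul_vecMulVec,
      Matrix.trace_vecMulVec]
    have hQ : ∀ φ, dotProduct (Q.mulVec φ) (star φ) =
        dotProduct (Q.mulVec φ) (star (Q.mulVec φ)) := by
      intro φ
      rw [Matrix.star_mulVec, h1, dotProduct_comm (Q.mulVec φ) (Matrix.vecMul _ _),
        ← Matrix.dotProduct_mulVec, Matrix.mulVec_mulVec, h2, dotProduct_comm]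
    rw [hQ]
    simp only [dotProduct, Pi.star_apply, RCLike.star_def, Complex.mul_conj', Complex.re_sum,
      ← Complex.ofReal_pow, Complex.ofReal_re]
  rw [tensorPower_depol, Finset.mul_sum, Matrix.trace_sum, Complex.re_sum]
  have hk : ∀ k : Fin n → Fin 4, (Q * (stringWeight p k : ℂ) • (pauliString k *
      Matrix.vecMulVec ψ (star ψ) * (pauliString k).conjTranspose)).trace.re =
        stringWeight p k * ∑ i, ‖(Q.mulVec ((pauliString k).mulVec ψ)) i‖ ^ 2 := by
    intro k
    rw [mul_smul_comm, Matrix.trace_smul, smul_eq_mul, Complex.re_ofReal_mul, hterm]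
  simp only [hk]
  calc ∑ k ∈ A, stringWeight p k
      = ∑ k ∈ A, stringWeight p k * ∑ i, ‖(Q.mulVec ((pauliString k).mulVec ψ)) i‖ ^ 2 := by
        refine Finset.sum_congr rfl fun k hkA => ?_
        rw [h4 k hkA, sum_norm_sq_mulVec (conjTranspose_pauliString_mul k) hψ, mul_one]
    _ ≤ _ := Finset.sum_le_univ_sum_of_nonneg fun k =>
        mul_nonneg (stringWeight_nonneg hp k) (Finset.sum_nonneg fun _ _ => by positivity)

end Ratio

/-! ### The expected contraction ratio -/

section Expectation

theorem IsStateDesign.integral_linear {d : Type*} [Fintype d] [DecidableEq d]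
    {μ : Measure (Matrix d d ℂ)} (hμ : IsStateDesign 2 μ) (L : Matrix d d ℂ →ₗ[ℂ] ℂ) :
    Integrable (fun ρ => L ρ) μ ∧ ∫ ρ, L ρ ∂μ = (Fintype.card d : ℂ)⁻¹ * L 1 := by
  obtain ⟨c, hL⟩ : ∃ c : d → d → ℂ, ∀ ρ, L ρ = ∑ i, ∑ j, ρ i j * c i j := by
    refine ⟨fun i j => L (Matrix.single i j 1), fun ρ => ?_⟩
    conv_lhs => rw [Matrix.matrix_eq_sum_single ρ]
    simp only [map_sum]
    refine Finset.sum_congr rfl fun i _ => Finset.sum_congr rfl fun j _ => ?_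
    rw [← smul_eq_mul, ← map_smul, Matrix.smul_single, smul_eq_mul, mul_one]
  have hi : ∀ i j : d, Integrable (fun ρ : Matrix d d ℂ => ρ i j * c i j) μ :=
    fun i j => (hμ.integrable_entry i j).mul_const _
  constructor
  · simp only [hL]
    exact integrable_finsetSum _ fun i _ => integrable_finsetSum _ fun j _ => hi i j
  · rw [hL 1]
    simp_rw [hL]
    rw [integral_finsetSum _ fun i _ => integrable_finsetSum _ fun j _ => hi i j]
    simp_rw [integral_finsetSum _ fun j _ => hi _ j, integral_mul_const, hμ.integral_entry]
    simp [Matrix.one_apply, Finset.mul_sum]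

variable {n : ℕ} {μ : Measure (Matrix (Fin n → Fin 2) (Fin n → Fin 2) ℂ)}

theorem measurable_sub_pair {d : Type*} :
    Measurable fun x : Matrix d d ℂ × Matrix d d ℂ => x.1 - x.2 := by
  refine measurable_pi_iff.2 fun i => measurable_pi_iff.2 fun j => ?_
  exact ((measurable_entry i j).comp measurable_fst).sub
    ((measurable_entry i j).comp measurable_snd)

theorem IsStateDesign.ae_pure_pair {d : Type*} [Fintype d] [DecidableEq d]
    {μ : Measure (Matrix d d ℂ)} (hμ : IsStateDesign 2 μ) :
    ∀ᵐ x ∂(μ.prod μ), IsPureState x.1 ∧ IsPureState x.2 := by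
  have := hμ.prob
  exact (Measure.quasiMeasurePreserving_fst.ae hμ.pure).and
    (Measure.quasiMeasurePreserving_snd.ae hμ.pure)

theorem IsStateDesign.aestronglyMeasurable_contractionRatio (hμ : IsStateDesign 2 μ) (p : ℝ) :
    AEStronglyMeasurable (contractionRatio p n) (μ.prod μ) := by
  set N : Matrix (Fin n → Fin 2) (Fin n → Fin 2) ℂ → ℝ :=
    fun X => traceNorm ((1 / 2 : ℂ) • (X + X.conjTranspose)) with hN
  have hNc : Continuous N := continuous_traceNorm_hermitianPart
  have hT : Continuous (tensorPower n (depol p)) :=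
    LinearMap.continuous_of_finiteDimensional _
  have hg : Measurable fun x : Matrix (Fin n → Fin 2) (Fin n → Fin 2) ℂ ×
      Matrix (Fin n → Fin 2) (Fin n → Fin 2) ℂ =>
      (1 / 2 * N (tensorPower n (depol p) (x.1 - x.2))) / (1 / 2 * N (x.1 - x.2)) :=
    (((hNc.comp hT).measurable.comp measurable_sub_pair).const_mul _).div
      ((hNc.measurable.comp measurable_sub_pair).const_mul _)
  refine hg.aestronglyMeasurable.congr ?_
  filter_upwards [hμ.ae_pure_pair] with x hx
  have hH := hx.1.isHermitian.sub hx.2.isHermitian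
  simp only [hN, contractionRatio, traceDist, ← map_sub]
  rw [hermitianPart_eq hH, hermitianPart_eq (isHermitian_tensorPower_depol p n hH)]

variable {p : ℝ}

theorem IsStateDesign.integrable_contractionRatio (hμ : IsStateDesign 2 μ)
    (hp : p ∈ Set.Icc (0 : ℝ) (4 / 3)) : Integrable (contractionRatio p n) (μ.prod μ) := by
  have := hμ.prob
  refine Integrable.of_bound (hμ.aestronglyMeasurable_contractionRatio p) 1 ?_
  filter_upwards [hμ.ae_pure_pair] with x hx
  rw [Real.norm_of_nonneg (contractionRatio_nonneg p x)]
  exact contractionRatio_le_one hp hx.1 hx.2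

/-- Whatever the first state, the projection that detects its output accepts the output of the
second state with probability at most `|A| / 2 ^ n`, because that state is maximally mixed on
average. -/
theorem IsStateDesign.le_integral_contractionRatio (hμ : IsStateDesign 2 μ)
    (hp : p ∈ Set.Icc (0 : ℝ) (4 / 3)) (A : Finset (Fin n → Fin 4)) :
    ∑ k ∈ A, stringWeight p k - A.card / 2 ^ n ≤ ∫ x, contractionRatio p n x ∂(μ.prod μ) := by
  have := hμ.prob
  have hint := hμ.integrable_contractionRatio hp
  rw [integral_prod _ hint]
  have hconst : ∑ k ∈ A, stringWeight p k - A.card / 2 ^ n =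
      ∫ _, (∑ k ∈ A, stringWeight p k - (A.card : ℝ) / 2 ^ n) ∂μ := by simp
  rw [hconst]
  refine integral_mono_ae (integrable_const _) hint.integral_prod_left ?_
  filter_upwards [hμ.pure, hint.prod_right_ae] with ρ hρ hρint
  obtain ⟨Q, h1, h2, h3, h4⟩ := exists_detecting_projection hp hρ A
  set L : Matrix (Fin n → Fin 2) (Fin n → Fin 2) ℂ →ₗ[ℂ] ℂ :=
    Matrix.traceLinearMap _ ℂ ℂ ∘ₗ LinearMap.mulLeft ℂ Q ∘ₗ tensorPower n (depol p) with hL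
  have hLapp : ∀ σ, L σ = (Q * tensorPower n (depol p) σ).trace := fun σ => rfl
  obtain ⟨hLi, hLint⟩ := hμ.integral_linear L
  have hLr : Integrable (fun σ => (L σ).re) μ := hLi.re
  have hre : ∫ σ, (L σ).re ∂μ ≤ A.card / 2 ^ n := by
    have e : ∫ σ, (L σ).re ∂μ = (∫ σ, L σ ∂μ).re := integral_re hLi
    rw [e, hLint, hLapp, tensorPower_depol_one, mul_one]
    have hc : (Fintype.card (Fin n → Fin 2) : ℂ)⁻¹ = (((2 ^ n : ℝ)⁻¹ : ℝ) : ℂ) := by simp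
    rw [hc, Complex.re_ofReal_mul, div_eq_inv_mul]
    exact mul_le_mul_of_nonneg_left h3 (by positivity)
  calc ∑ k ∈ A, stringWeight p k - A.card / 2 ^ n
      ≤ (L ρ).re - ∫ σ, (L σ).re ∂μ := sub_le_sub h4 hre
    _ = ∫ σ, ((L ρ).re - (L σ).re) ∂μ := by
        rw [integral_sub (integrable_const _) hLr]; simp
    _ ≤ ∫ σ, contractionRatio p n (ρ, σ) ∂μ := by
        refine integral_mono_ae ((integrable_const _).sub hLr) hρint ?_
        filter_upwards [hμ.pure] with σ hσ
        refine le_trans ?_ (traceDist_tensorPower_le_contractionRatio hp hρ hσ)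
        have ht : (tensorPower n (depol p) ρ - tensorPower n (depol p) σ).trace = 0 := by
          rw [Matrix.trace_sub, trace_tensorPower_depol, trace_tensorPower_depol,
            hρ.trace_eq_one, hσ.trace_eq_one, sub_self]
        have := re_trace_projection_mul_le h1 h2 ht
        rw [mul_sub, Matrix.trace_sub, Complex.sub_re] at this
        exact this

/-- The number `s ^ 2` is the growth rate of `D 𝔼 ‖T (ρ - σ)‖₂²`, and the bound is that of
`contractionRatio_le` with `ε = s ^ n`, which makes its first two terms comparable. -/
theorem IsStateDesign.integral_contractionRatio_le (hμ : IsStateDesign 2 μ)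
    (hp : p ∈ Set.Icc (0 : ℝ) (4 / 3)) {s : ℝ} (hs : 0 < s)
    (hsp : s ^ 2 = (1 + 3 * (1 - p) ^ 2) / 2) :
    ∫ x, contractionRatio p n x ∂(μ.prod μ) ≤ 3 / 2 * s ^ n + 2 * (1 / 2) ^ n := by
  have := hμ.prob
  have hε : 0 < s ^ n := pow_pos hs n
  have hi1 := hμ.integrable_trace_tensorPower_sq p
  obtain ⟨hi2, he2⟩ := hμ.integral_trace_mul
  have he1 := hμ.integral_trace_tensorPower_sq p
  have hr1 := integral_re hi1
  have hr2 := integral_re hi2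
  simp only [RCLike.re_eq_complex_re] at hr1 hr2
  rw [he1, Complex.ofReal_re] at hr1
  have hc : (Fintype.card (Fin n → Fin 2) : ℂ)⁻¹ = (((1 / 2 : ℝ) ^ n : ℝ) : ℂ) := by simp
  rw [he2, hc, Complex.ofReal_re] at hr2
  have hmono : ∫ x, contractionRatio p n x ∂(μ.prod μ) ≤
      ∫ x : Matrix (Fin n → Fin 2) (Fin n → Fin 2) ℂ × Matrix (Fin n → Fin 2) (Fin n → Fin 2) ℂ,
        (s ^ n + 2 ^ n / (4 * s ^ n) * (tensorPower n (depol p) (x.1 - x.2) *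
          tensorPower n (depol p) (x.1 - x.2)).trace.re + 2 * (x.1 * x.2).trace.re)
        ∂(μ.prod μ) := by
    refine integral_mono_ae (hμ.integrable_contractionRatio hp)
      (((integrable_const _).add (hi1.re.const_mul _)).add (hi2.re.const_mul _)) ?_
    filter_upwards [hμ.ae_pure_pair] with x hx
    exact contractionRatio_le hp hx.1 hx.2 hε
  refine hmono.trans ?_
  have e1 := integral_add (μ := μ.prod μ)
    (f := fun x : Matrix (Fin n → Fin 2) (Fin n → Fin 2) ℂ ×
      Matrix (Fin n → Fin 2) (Fin n → Fin 2) ℂ => s ^ n + 2 ^ n / (4 * s ^ n) *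
        (tensorPower n (depol p) (x.1 - x.2) * tensorPower n (depol p) (x.1 - x.2)).trace.re)
    (g := fun x => 2 * (x.1 * x.2).trace.re)
    ((integrable_const _).add (hi1.re.const_mul _)) (hi2.re.const_mul _)
  have e2 := integral_add (μ := μ.prod μ)
    (f := fun _ : Matrix (Fin n → Fin 2) (Fin n → Fin 2) ℂ ×
      Matrix (Fin n → Fin 2) (Fin n → Fin 2) ℂ => s ^ n)
    (g := fun x => 2 ^ n / (4 * s ^ n) *
        (tensorPower n (depol p) (x.1 - x.2) * tensorPower n (depol p) (x.1 - x.2)).trace.re)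
    (integrable_const _) (hi1.re.const_mul _)
  rw [e1, e2, integral_const_mul, integral_const_mul, hr1, hr2]
  simp only [integral_const, probReal_univ, one_smul]
  have hm := output_moment_le n (g := 1 + 3 * (1 - p) ^ 2) (by positivity)
  rw [← hsp, ← pow_mul, mul_comm 2 n, pow_mul] at hm
  have h2 : (0 : ℝ) < 2 ^ n := by positivity
  have hmul := mul_le_mul_of_nonneg_left hm (show 0 ≤ 2 ^ n / (4 * s ^ n) by positivity)
  have e : 2 ^ n / (4 * s ^ n) * (2 * (s ^ n) ^ 2 / 2 ^ n) = 1 / 2 * s ^ n := by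
    field_simp; norm_num
  rw [e] at hmul
  linarith

/-! ### Conditioning on distinct states -/

theorem traceContraction_one (ν : Measure (Matrix (Fin n → Fin 2) (Fin n → Fin 2) ℂ ×
    Matrix (Fin n → Fin 2) (Fin n → Fin 2) ℂ)) :
    traceContraction 1 (tensorPower n (depol p)) ν = ∫ x, contractionRatio p n x ∂ν := by
  simp only [traceContraction, Real.rpow_one, div_one, contractionRatio]

/-- Pairs of equal states do not contribute, since `0 / 0 = 0`. -/
theorem setIntegral_contractionRatio (ν : Measure (Matrix (Fin n → Fin 2) (Fin n → Fin 2) ℂ ×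
    Matrix (Fin n → Fin 2) (Fin n → Fin 2) ℂ)) :
    ∫ x in {x | x.1 ≠ x.2}, contractionRatio p n x ∂ν = ∫ x, contractionRatio p n x ∂ν := by
  refine setIntegral_eq_integral_of_forall_compl_eq_zero fun x hx => ?_
  obtain ⟨ρ, σ⟩ := x
  have hx' : ρ = σ := by simpa using hx
  rw [hx', contractionRatio_self]

theorem integral_distinctPairs (μ : Measure (Matrix (Fin n → Fin 2) (Fin n → Fin 2) ℂ)) :
    ∫ x, contractionRatio p n x ∂(distinctPairs μ) =
      ((μ.prod μ).real {x | x.1 ≠ x.2})⁻¹ * ∫ x, contractionRatio p n x ∂(μ.prod μ) := by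
  rw [distinctPairs, ProbabilityTheory.cond, integral_smul_measure, setIntegral_contractionRatio,
    ENNReal.toReal_inv, smul_eq_mul]
  rfl

theorem IsStateDesign.integral_contractionRatio_le_real (hμ : IsStateDesign 2 μ)
    (hp : p ∈ Set.Icc (0 : ℝ) (4 / 3)) :
    ∫ x, contractionRatio p n x ∂(μ.prod μ) ≤ (μ.prod μ).real {x | x.1 ≠ x.2} := by
  have := hμ.prob
  rw [← setIntegral_contractionRatio]
  have h1 : ∫ x in {x : Matrix (Fin n → Fin 2) (Fin n → Fin 2) ℂ ×
      Matrix (Fin n → Fin 2) (Fin n → Fin 2) ℂ | x.1 ≠ x.2}, (1 : ℝ) ∂(μ.prod μ) =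
      (μ.prod μ).real {x | x.1 ≠ x.2} := by simp
  rw [← h1]
  refine integral_mono_ae (hμ.integrable_contractionRatio hp).restrict (integrable_const _) ?_
  filter_upwards [ae_restrict_of_ae hμ.ae_pure_pair] with x hx
  exact contractionRatio_le_one hp hx.1 hx.2

/-- Two independent states collide with probability at most `1 / 2 ^ n`. -/
theorem IsStateDesign.one_sub_le_real (hμ : IsStateDesign 2 μ) :
    1 - (1 / 2) ^ n ≤ (μ.prod μ).real {x | x.1 ≠ x.2} := by
  have := hμ.prob
  have hms : MeasurableSet {x : Matrix (Fin n → Fin 2) (Fin n → Fin 2) ℂ ×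
      Matrix (Fin n → Fin 2) (Fin n → Fin 2) ℂ | x.1 ≠ x.2} := by
    have : {x : Matrix (Fin n → Fin 2) (Fin n → Fin 2) ℂ ×
      Matrix (Fin n → Fin 2) (Fin n → Fin 2) ℂ | x.1 ≠ x.2} =
        (fun x : Matrix (Fin n → Fin 2) (Fin n → Fin 2) ℂ ×
          Matrix (Fin n → Fin 2) (Fin n → Fin 2) ℂ => x.1 - x.2) ⁻¹' {0}ᶜ := by
      ext x; simp [sub_eq_zero]
    rw [this]
    exact measurable_sub_pair (measurableSet_singleton 0).compl
  obtain ⟨hi2, he2⟩ := hμ.integral_trace_mul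
  have hr2 := integral_re hi2
  simp only [RCLike.re_eq_complex_re] at hr2
  have hc : (Fintype.card (Fin n → Fin 2) : ℂ)⁻¹ = (((1 / 2 : ℝ) ^ n : ℝ) : ℂ) := by simp
  rw [he2, hc, Complex.ofReal_re] at hr2
  have h1 : (μ.prod μ).real {x | x.1 ≠ x.2}ᶜ ≤ (1 / 2) ^ n := by
    rw [← hr2, ← integral_indicator_one hms.compl]
    refine integral_mono_ae ((integrable_const (1 : ℝ)).indicator hms.compl) hi2.re ?_
    filter_upwards [hμ.ae_pure_pair] with x hx
    by_cases hxx : x.1 = x.2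
    · rw [Set.indicator_of_mem (by simpa using hxx)]
      simp [← hxx, hx.1.trace_mul_self]
    · rw [Set.indicator_of_notMem (by simpa using hxx)]
      exact hx.1.re_trace_mul_nonneg hx.2
  rw [probReal_compl_eq_one_sub hms] at h1
  linarith

end Expectation

/-! ### Limits of the average contraction -/

section Limits

variable {p : ℝ} {μ : (n : ℕ) → Measure (Matrix (Fin n → Fin 2) (Fin n → Fin 2) ℂ)}

theorem tendsto_traceContraction_one (hp : p ∈ Set.Icc (0 : ℝ) (4 / 3))
    (hμ : ∀ n, IsStateDesign 2 (μ n)) (hS : choiEntropy p < Real.log 2) :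
    Tendsto (fun n => traceContraction 1 (tensorPower n (depol p)) ((μ n).prod (μ n)))
        atTop (𝓝 1) ∧
      Tendsto (fun n => traceContraction 1 (tensorPower n (depol p)) (distinctPairs (μ n)))
        atTop (𝓝 1) := by
  simp only [traceContraction_one]
  obtain ⟨a, b, ha0, ha1, hb0, hb1, hab⟩ := exists_typical hp hS
  have hlow : ∀ n, 1 - b ^ n - a ^ n ≤ ∫ x, contractionRatio p n x ∂((μ n).prod (μ n)) := by
    intro n
    obtain ⟨A, hA, hw⟩ := hab n
    refine le_trans ?_ ((hμ n).le_integral_contractionRatio hp A)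
    have h2 : (0 : ℝ) < 2 ^ n := by positivity
    have : (A.card : ℝ) / 2 ^ n ≤ a ^ n := by
      rw [div_le_iff₀ h2, mul_comm, ← mul_pow]; exact hA
    linarith
  have hlim : Tendsto (fun n : ℕ => 1 - b ^ n - a ^ n) atTop (𝓝 1) := by
    simpa using ((tendsto_const_nhds (x := (1 : ℝ))).sub
      (tendsto_pow_atTop_nhds_zero_of_lt_one hb0 hb1)).sub
        (tendsto_pow_atTop_nhds_zero_of_lt_one ha0 ha1)
  have hP : ∀ n, ∫ x, contractionRatio p n x ∂((μ n).prod (μ n)) ≤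
      ((μ n).prod (μ n)).real {x | x.1 ≠ x.2} :=
    fun n => (hμ n).integral_contractionRatio_le_real hp
  have hP1 : ∀ n, ((μ n).prod (μ n)).real {x | x.1 ≠ x.2} ≤ 1 := by
    intro n
    have := (hμ n).prob
    exact measureReal_le_one
  have h0 : ∀ n, 0 ≤ ∫ x, contractionRatio p n x ∂((μ n).prod (μ n)) :=
    fun n => integral_nonneg fun x => contractionRatio_nonneg p x
  refine ⟨tendsto_of_tendsto_of_tendsto_of_le_of_le hlim tendsto_const_nhds hlow
    fun n => (hP n).trans (hP1 n), ?_⟩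
  refine tendsto_of_tendsto_of_tendsto_of_le_of_le hlim tendsto_const_nhds
    (fun n => (hlow n).trans ?_) fun n => ?_
  · rw [integral_distinctPairs]
    rcases ((h0 n).trans (hP n)).eq_or_lt with hz | hz
    · rw [le_antisymm ((hP n).trans hz.ge) (h0 n), mul_zero]
    · exact le_mul_of_one_le_left (h0 n) ((one_le_inv₀ hz).2 (hP1 n))
  · rw [integral_distinctPairs]
    exact inv_mul_le_one_of_le₀ (hP n) ((h0 n).trans (hP n))

theorem tendsto_traceContraction_zero (hp : p ∈ Set.Icc (0 : ℝ) (4 / 3))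
    (hμ : ∀ n, IsStateDesign 2 (μ n)) (h : 1 - 1 / Real.sqrt 3 < p) :
    Tendsto (fun n => traceContraction 1 (tensorPower n (depol p)) ((μ n).prod (μ n)))
        atTop (𝓝 0) ∧
      Tendsto (fun n => traceContraction 1 (tensorPower n (depol p)) (distinctPairs (μ n)))
        atTop (𝓝 0) := by
  simp only [traceContraction_one]
  have hq : (1 - p) ^ 2 < 1 / 3 := by
    have e : (1 / Real.sqrt 3) ^ 2 = 1 / 3 := by
      rw [div_pow, Real.sq_sqrt (by norm_num), one_pow]
    rw [← e]
    -- As `1 - p ≥ -1 / 3`, the lower bound on `1 - p` is automatic.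
    have hl : (1 : ℝ) / 3 < 1 / Real.sqrt 3 := by
      apply one_div_lt_one_div_of_lt (Real.sqrt_pos.2 (by norm_num))
      rw [Real.sqrt_lt' (by norm_num)]; norm_num
    exact sq_lt_sq' (by linarith [hp.2]) (by linarith)
  set s := Real.sqrt ((1 + 3 * (1 - p) ^ 2) / 2) with hs
  have hs0 : 0 < s := Real.sqrt_pos.2 (by positivity)
  have hs2 : s ^ 2 = (1 + 3 * (1 - p) ^ 2) / 2 := Real.sq_sqrt (by positivity)
  have hs1 : s < 1 := by
    rw [hs, Real.sqrt_lt' one_pos]; linarith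
  have hup : ∀ n, ∫ x, contractionRatio p n x ∂((μ n).prod (μ n)) ≤
      3 / 2 * s ^ n + 2 * (1 / 2) ^ n :=
    fun n => (hμ n).integral_contractionRatio_le hp hs0 hs2
  have h0 : ∀ n, 0 ≤ ∫ x, contractionRatio p n x ∂((μ n).prod (μ n)) :=
    fun n => integral_nonneg fun x => contractionRatio_nonneg p x
  have hlim : Tendsto (fun n : ℕ => 3 / 2 * s ^ n + 2 * (1 / 2 : ℝ) ^ n) atTop (𝓝 0) := by
    simpa using ((tendsto_pow_atTop_nhds_zero_of_lt_one hs0.le hs1).const_mul (3 / 2)).add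
      ((tendsto_pow_atTop_nhds_zero_of_lt_one (r := (1 / 2 : ℝ)) (by norm_num)
        (by norm_num)).const_mul 2)
  have hmain := squeeze_zero h0 hup hlim
  refine ⟨hmain, ?_⟩
  refine squeeze_zero' (Eventually.of_forall fun n =>
    integral_nonneg fun x => contractionRatio_nonneg p x) ?_ (by simpa using hmain.const_mul 2)
  filter_upwards [eventually_ge_atTop 1] with n hn
  rw [integral_distinctPairs]
  have hhalf : (1 / 2 : ℝ) ^ n ≤ 1 / 2 := by
    simpa using pow_le_pow_of_le_one (by norm_num : (0 : ℝ) ≤ 1 / 2) (by norm_num) hn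
  have hP : 1 / 2 ≤ ((μ n).prod (μ n)).real {x | x.1 ≠ x.2} := by
    linarith [(hμ n).one_sub_le_real]
  refine mul_le_mul_of_nonneg_right ?_ (h0 n)
  have := inv_anti₀ (by norm_num) hP
  norm_num at this ⊢
  exact this

end Limits

end QContraction

end

open QContraction in
theorem mainTheorem2 :
    ∃ p₁ : ℝ, |p₁ - 0.25| < 0.005 ∧ |(1 - 1 / Real.sqrt 3) - 0.42| < 0.005 ∧
      (∀ p ∈ Set.Icc (0 : ℝ) (4 / 3), entropy (choi (depol p)) = 1 ↔ p = p₁) ∧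
      (∀ p ∈ Set.Icc (0 : ℝ) (4 / 3),
        (1 - 3 / 4 * p) * Real.logb 2 (1 - 3 / 4 * p) + 3 * p / 4 * Real.logb 2 (p / 4) = -1 ↔
          p = p₁) ∧
      ∀ p ∈ Set.Icc (0 : ℝ) (4 / 3),
      ∀ μ : (n : ℕ) → Measure (Matrix (Fin n → Fin 2) (Fin n → Fin 2) ℂ),
        (∀ n, IsStateDesign 2 (μ n)) →
        (p < p₁ →
          Tendsto (fun n => traceContraction 1 (tensorPower n (depol p)) ((μ n).prod (μ n)))
            atTop (𝓝 1) ∧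
          Tendsto (fun n => traceContraction 1 (tensorPower n (depol p)) (distinctPairs (μ n)))
            atTop (𝓝 1)) ∧
        (1 - 1 / Real.sqrt 3 < p →
          Tendsto (fun n => traceContraction 1 (tensorPower n (depol p)) ((μ n).prod (μ n)))
            atTop (𝓝 0) ∧
          Tendsto (fun n => traceContraction 1 (tensorPower n (depol p)) (distinctPairs (μ n)))
            atTop (𝓝 0)) := by
  obtain ⟨p₁, h1, h2, h3⟩ := exists_threshold
  have hlog : 0 < Real.log 2 := Real.log_pos (by norm_num)
  refine ⟨p₁, h1, abs_one_sub_one_div_sqrt_three_sub, fun p hp => ?_, fun p hp => ?_,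
    fun p hp μ hμ => ⟨fun h => tendsto_traceContraction_one hp hμ (h3 p hp h),
      fun h => tendsto_traceContraction_zero hp hμ h⟩⟩
  · rw [entropy_choi_depol, choiEntropy_eq, neg_neg, div_eq_one_iff_eq hlog.ne', h2 p hp]
  · rw [choiEntropy_eq, neg_inj, div_eq_one_iff_eq hlog.ne', h2 p hp]
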